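/- Let $G=\mathrm{SL}(3,\mathbb{R})$, $\Gamma=\mathrm{SL}(3,\mathbb{Z})$ and $X=G/\Gamma$, on which $G$ acts by left translation. Let $A<G$ be the group of positive diagonal matrices of determinant one, for $s,t\in\mathbb{R}$ put $$a_{s,t}=\begin{pmatrix}e^{-s-t}&0&0\\0&e^{s}&0\\0&0&e^{t}\end{pmatrix}\in A,\qquad a_1=a_{1,0},$$ and let $$U=\left\{\begin{pmatrix}1&0&0\\u_1&1&0\\u_2&0&1\end{pmatrix}\ \middle|\ u_1,u_2\in\mathbb{R}\right\}<G,$$ with the metric $d_U(u,v)=\max\{|u_1-v_1|,|u_2-v_2|\}$; let $\overline{B^U_1}$ be the closed unit ball of $U$ around the identity. For $x\in X$ and $T>0$ define the Borel probability measure $$\delta^T_{A^+,x}=\frac{1}{T^2}\int_{[0,T]^2}\delta_{a_{s,t}x}\,ds\,dt$$ on $X$. We say that $\delta^T_{A^+,x}$ accumulates as $T\to\infty$ to a finite Borel measure $\mu$ on $X$ if there are $T_k>0$ with $T_k\to\infty$ such that $\int_X f\,d\delta^{T_k}_{A^+,x}\to\int_X f\,d\mu$ as $k\to\infty$ for every $f\in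 C_0(X)$ (the continuous functions on $X$ vanishing at infinity). For an $a_1$-invariant Borel probability measure $\nu$ on $X$, let $h_\nu(a_1)$ be the measure-theoretic (Kolmogorov--Sinai) entropy, in natural logarithms, of $x\mapsto a_1x$ with respect to $\nu$. Theorem. Let $x_0\in X$ and $0<\gamma<1$. Let $Z_{x_0}(\gamma)$ be the set of all $u\in\overline{B^U_1}$ such that $\delta^T_{A^+,ux_0}$ accumulates as $T\to\infty$ to some $A$-invariant finite Borel measure $\mu$ on $X$ with $$1-\gamma<\mu(X)\le 1\quad\text{and}\quad h_{\widehat\mu}(a_1)\le\gamma,$$ where $\widehat\mu=\mu(X)^{-1}\mu$. Then the Hausdorff dimension of $Z_{x_0}(\gamma)$ with respect to $d_U$ satisfies $$\dim_H Z_{x_0}(\gamma)\le 15\sqrt{\gamma}.$$ -/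

import Mathlib

open MeasureTheory Filter Topology
open scoped ENNReal ZeroAtInfty

noncomputable section

namespace DiagFlow

/-- `G = SL(3, ℝ)`, with the topology it inherits from the matrices. -/
abbrev G : Type := Matrix.SpecialLinearGroup (Fin 3) ℝ

/-- `Γ = SL(3, ℤ)`, as a subgroup of `G`. -/
abbrev Γ : Subgroup G := (Matrix.SpecialLinearGroup.map (n := Fin 3) (Int.castRingHom ℝ)).range

/-- `X = G / Γ`, with the quotient topology and the action of `G` by left translation. -/
abbrev X : Type := G ⧸ Γ

/-- `X` carries its Borel σ-algebra. -/
instance instMeasurableSpaceX : MeasurableSpace X := borel X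

instance instBorelSpaceX : BorelSpace X := ⟨rfl⟩

/-- `A`: the positive diagonal matrices of determinant one. -/
def A : Set G := {g | (g : Matrix (Fin 3) (Fin 3) ℝ).IsDiag ∧ ∀ i, 0 < g i i}

/-- `a_{s,t} = diag(e^{-s-t}, e^s, e^t)`. -/
def a (s t : ℝ) : G :=
  ⟨Matrix.diagonal ![Real.exp (-s - t), Real.exp s, Real.exp t], by
    rw [Matrix.det_diagonal, Fin.prod_univ_three]
    simp only [Matrix.cons_val_zero, Matrix.cons_val_one, Matrix.cons_val]
    rw [← Real.exp_add, ← Real.exp_add, ← Real.exp_zero]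
    congr 1
    ring⟩

/-- `τ_{α,β}`: the lower unipotent matrix with first column `(1, α, β)` and otherwise the entries
of the identity matrix. -/
def τ (α β : ℝ) : G :=
  ⟨!![1, 0, 0; α, 1, 0; β, 0, 1], by simp [Matrix.det_fin_three]⟩

theorem τ_mul (α β α' β' : ℝ) : τ α β * τ α' β' = τ (α + α') (β + β') := by
  apply Subtype.ext
  rw [Matrix.SpecialLinearGroup.coe_mul]
  ext i j
  fin_cases i <;> fin_cases j <;> simp [τ, Matrix.mul_apply, Fin.sum_univ_three]

theorem τ_zero : τ 0 0 = 1 := by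
  apply Subtype.ext
  ext i j
  fin_cases i <;> fin_cases j <;> simp [τ]

/-- The closed subgroup `U = {τ_{u₁,u₂} | u₁, u₂ ∈ ℝ}` of `G`. -/
def U : Subgroup G where
  carrier := {g | ∃ u₁ u₂ : ℝ, g = τ u₁ u₂}
  mul_mem' := by
    rintro _ _ ⟨u₁, u₂, rfl⟩ ⟨v₁, v₂, rfl⟩
    exact ⟨_, _, τ_mul u₁ u₂ v₁ v₂⟩
  one_mem' := ⟨0, 0, τ_zero.symm⟩
  inv_mem' := by
    rintro _ ⟨u₁, u₂, rfl⟩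
    refine ⟨-u₁, -u₂, inv_eq_of_mul_eq_one_right ?_⟩
    rw [τ_mul, add_neg_cancel, add_neg_cancel, τ_zero]

/-- The coordinates `(u₁, u₂)` of an element of `U`. -/
def coordU (u : U) : ℝ × ℝ := ((u : G) 1 0, (u : G) 2 0)

theorem coordU_mk (p : ℝ × ℝ) : coordU ⟨τ p.1 p.2, p.1, p.2, rfl⟩ = p := by
  simp [coordU, τ]

theorem mk_coordU (u : U) : (⟨τ (coordU u).1 (coordU u).2, _, _, rfl⟩ : U) = u := by
  obtain ⟨_, u₁, u₂, rfl⟩ := u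
  simp [coordU, τ]

/-- The coordinates identify `U`, with the topology induced from `G`, with `ℝ²`. -/
def homeoU : U ≃ₜ ℝ × ℝ where
  toFun := coordU
  invFun p := ⟨τ p.1 p.2, p.1, p.2, rfl⟩
  left_inv := mk_coordU
  right_inv := coordU_mk
  continuous_toFun := by
    have h : Continuous fun u : U => ((u : G) : Matrix (Fin 3) (Fin 3) ℝ) :=
      continuous_subtype_val.comp continuous_subtype_val
    exact (h.matrix_elem 1 0).prodMk (h.matrix_elem 2 0)
  continuous_invFun := by
    refine Continuous.subtype_mk (Continuous.subtype_mk ?_ _) _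
    refine continuous_matrix fun i j => ?_
    fin_cases i <;> fin_cases j <;> simp <;> fun_prop

/-- The metric `d_U(u, v) = max {|u₁ - v₁|, |u₂ - v₂|}` on `U` (the distance of `ℝ × ℝ` is the
maximum distance); it induces the topology that `U` has as a subspace of `G`. -/
instance instMetricSpaceU : MetricSpace U :=
  (MetricSpace.induced coordU homeoU.injective inferInstance).replaceTopology
    homeoU.isInducing.eq_induced

theorem dist_U (u v : U) :
    dist u v = max |(u : G) 1 0 - (v : G) 1 0| |(u : G) 2 0 - (v : G) 2 0| := rfl

/-- The empirical measure `δ^T_{A⁺,x} = T⁻² ∫_{[0,T]²} δ_{a_{s,t} x} ds dt`, that is, `T⁻²` times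
the image of Lebesgue measure on `[0,T]²` under `(s, t) ↦ a_{s,t} x`. -/
def empirical (T : ℝ) (x : X) : Measure X :=
  (ENNReal.ofReal (T ^ 2))⁻¹ •
    (volume.restrict (Set.Icc (0 : ℝ) T ×ˢ Set.Icc (0 : ℝ) T)).map
      (fun p : ℝ × ℝ => a p.1 p.2 • x)

/-- `μ_k → μ`: convergence of the integrals of all `f ∈ C₀(X)`. -/
def ConvergesTo (μs : ℕ → Measure X) (μ : Measure X) : Prop :=
  ∀ f : C₀(X, ℝ), Tendsto (fun k => ∫ x, f x ∂(μs k)) atTop (𝓝 (∫ x, f x ∂μ))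

/-- `δ^T_{A⁺,x}` accumulates to `μ` as `T → ∞`. -/
def EmpiricalAccumulatesTo (x : X) (μ : Measure X) : Prop :=
  ∃ T : ℕ → ℝ, (∀ k, 0 < T k) ∧ Tendsto T atTop atTop ∧
    ConvergesTo (fun k => empirical (T k) x) μ

/-- `μ` is invariant under the action of `A` on `X`. -/
def AInvariant (μ : Measure X) : Prop :=
  ∀ g ∈ A, μ.map (fun x : X => g • x) = μ

section Entropy

variable {Y : Type*} [MeasurableSpace Y]

/-- The Shannon entropy `H_μ(ξ ∨ f⁻¹ξ ∨ ⋯ ∨ f^{-(n-1)}ξ)`, in natural logarithms. A finite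
partition of `Y` is written as the map `ξ : Y → Fin k` which sends a point to the index of its
piece; the pieces of the join are then indexed by the words `w` of length `n`, and empty pieces
contribute `0`. -/
def joinEntropy (μ : Measure Y) (f : Y → Y) {k : ℕ} (ξ : Y → Fin k) (n : ℕ) : ℝ :=
  ∑ w : Fin n → Fin k, Real.negMulLog (μ.real {y | ∀ i : Fin n, ξ (f^[i] y) = w i})

/-- `h_μ(f, ξ) = lim_n H_μ(ξ ∨ ⋯ ∨ f^{-(n-1)}ξ) / n`. The limit exists for an `f`-invariant
probability measure `μ`; it is written as an upper limit. -/
def partitionEntropy (μ : Measure Y) (f : Y → Y) {k : ℕ} (ξ : Y → Fin k) : ℝ≥0∞ :=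
  limsup (fun n : ℕ => ENNReal.ofReal (joinEntropy μ f ξ n / n)) atTop

/-- The measure-theoretic (Kolmogorov–Sinai) entropy `h_μ(f)`: the supremum of `h_μ(f, ξ)` over
all finite measurable partitions `ξ` of `Y`. -/
def entropy (μ : Measure Y) (f : Y → Y) : ℝ≥0∞ :=
  ⨆ (k : ℕ) (ξ : Y → Fin k) (_ : Measurable ξ), partitionEntropy μ f ξ

end Entropy

/-- `Z_{x₀}(γ)`: the set of `u` in the closure of the unit ball about `e` in `U` such that the
empirical measures of `u x₀` accumulate to an `A`-invariant finite Borel measure `μ` on `X` with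
`1 - γ < μ(X) ≤ 1` whose normalization `μ(X)⁻¹ μ` has entropy at most `γ` with respect to
`a₁ = a_{1,0}`. -/
def Z (x₀ : X) (γ : ℝ) : Set U :=
  {u | u ∈ closure (Metric.ball (1 : U) 1) ∧
    ∃ μ : Measure X, IsFiniteMeasure μ ∧ EmpiricalAccumulatesTo ((u : G) • x₀) μ ∧
      AInvariant μ ∧ ENNReal.ofReal (1 - γ) < μ Set.univ ∧ μ Set.univ ≤ 1 ∧
      entropy ((μ Set.univ)⁻¹ • μ) (fun x : X => a 1 0 • x) ≤ ENNReal.ofReal γ}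

end DiagFlow

end

/-!
Small entropy of the limit measure makes the orbits cheap to describe, and points of `U` whose
orbits are cheap to describe are covered by few small squares.

Cost functions. Call `g : X → ℝ` a coding cost (`IsCodingCost`) if, inside a small square of `U`,
the `v` for which the sum of `g` along the first `n` points of the `a₁`-orbit of `v y` is at most
`E` are covered by `O(e^E)` sets of diameter `O(e^{-n})`, uniformly in `y`. Let `μ` be a limit
measure as in the definition of `Z`. Because `Γ` is discrete, `X` has a finite partition with
`μ`-null boundaries whose pieces, apart from one piece `∞` that carries little mass, are so small
that points on a common piece of a `U`-orbit which lie in the same piece of the partition are very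
close (`exists_partition`). Since `μ` has entropy at most `γ`, for some `N` the next letter of an
itinerary, given the `N` letters before it, has conditional entropy barely above `γ`
(`exists_entropy_increment_le`); the mass that escaped to infinity is counted as if it stayed in
`∞` forever. The conditional code length of the next letter, plus `6` for every visit to `∞`, is a
coding cost: the itinerary determines the point of `U` except during visits to `∞`, where the
image of a square of side `η` is cut into `17² ≤ e⁶` squares by hand (`cov_of_cost`). Its mean,
with the escaped mass included, is at most `γ + 6γ` up to small errors, hence below `8γ`, and a
continuous majorant that is constant off a compact set has almost the same mean
(`exists_codingCost`). By separability countably many such majorants suffice for all `μ` together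
(`exists_countable_costs`).

Covering. Fix such a cost `g` and let `u` be such that the mean of `g` over `a_{s,t} u x₀`,
`(s,t) ∈ [0,T]²`, is below `8γ`. Then on some horizontal line `t = t₀` with `t₀ ≤ √γ T` the mean
is at most `8γ / √γ = 8√γ` (`exists_line_sum_le`). Reaching this line takes `O(e^{3 t₀})` squares
of `U`, as the product of the two stretching factors of `a_{0,t}` is `e^{3t}`, and following the
line up to time `T` takes another factor `e^{8√γ T}`. All in all `O(T e^{(3 + 8 + 1)√γ T})` sets of
diameter `O(e^{-T})` cover these `u` (`exists_cov_cheapAt`; the last `√γ` pays for rounding `t₀`),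
and `12 < 15`.
-/

namespace DiagFlow

/-! ### The space `X` and the action of `U` and `A` -/

instance : LocallyCompactSpace G :=
  haveI : LocallyCompactSpace (Matrix (Fin 3) (Fin 3) ℝ) :=
    inferInstanceAs (LocallyCompactSpace (Fin 3 → Fin 3 → ℝ))
  Matrix.SpecialLinearGroup.isClosedEmbedding_val.locallyCompactSpace

instance : SecondCountableTopology G :=
  haveI : SecondCountableTopology (Matrix (Fin 3) (Fin 3) ℝ) :=
    inferInstanceAs (SecondCountableTopology (Fin 3 → Fin 3 → ℝ))
  Matrix.SpecialLinearGroup.isClosedEmbedding_val.isEmbedding.secondCountableTopology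

/-- An element of `U` given by its pair of coordinates. -/
noncomputable def unip (v : ℝ × ℝ) : G := τ v.1 v.2

theorem unip_add (v w : ℝ × ℝ) : unip (v + w) = unip v * unip w := (τ_mul _ _ _ _).symm

theorem continuous_unip : Continuous unip :=
  continuous_subtype_val.comp homeoU.symm.continuous

theorem unip_zero : unip 0 = 1 := τ_zero

theorem unip_eq_one {v : ℝ × ℝ} (h : unip v = 1) : v = 0 := by
  have h1 : (unip v : Matrix (Fin 3) (Fin 3) ℝ) 1 0 = 0 := by rw [h]; simp
  have h2 : (unip v : Matrix (Fin 3) (Fin 3) ℝ) 2 0 = 0 := by rw [h]; simp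
  simp only [unip, τ] at h1 h2
  exact Prod.ext (by simpa using h1) (by simpa using h2)

/-- The factors by which conjugation with `a_{s,t}` stretches the two coordinates of `U`. -/
noncomputable def stretch (s t : ℝ) (v : ℝ × ℝ) : ℝ × ℝ :=
  (Real.exp (2 * s + t) * v.1, Real.exp (s + 2 * t) * v.2)

theorem a_mul_unip (s t : ℝ) (v : ℝ × ℝ) : a s t * unip v = unip (stretch s t v) * a s t := by
  apply Subtype.ext
  rw [Matrix.SpecialLinearGroup.coe_mul, Matrix.SpecialLinearGroup.coe_mul]
  have e1 : Real.exp (2 * s + t) * v.1 * Real.exp (-s - t) = Real.exp s * v.1 := by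
    rw [mul_right_comm, ← Real.exp_add]; ring_nf
  have e2 : Real.exp (s + 2 * t) * v.2 * Real.exp (-s - t) = Real.exp t * v.2 := by
    rw [mul_right_comm, ← Real.exp_add]; ring_nf
  ext i j
  fin_cases i <;> fin_cases j <;>
    simp [a, unip, stretch, τ, Matrix.mul_apply, Matrix.diagonal, e1, e2]

theorem a_mul_a (s t s' t' : ℝ) : a s t * a s' t' = a (s + s') (t + t') := by
  apply Subtype.ext
  rw [Matrix.SpecialLinearGroup.coe_mul]
  simp only [a, Matrix.diagonal_mul_diagonal]
  congr 1
  ext i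
  fin_cases i <;> simp [← Real.exp_add]
  ring_nf

theorem a_zero : a 0 0 = 1 := by
  apply Subtype.ext
  ext i j
  fin_cases i <;> fin_cases j <;> simp [a]

theorem a_mem_A (s t : ℝ) : a s t ∈ A := by
  refine ⟨Matrix.isDiag_diagonal _, fun i => ?_⟩
  fin_cases i <;> simp [a, Real.exp_pos]

theorem continuous_a : Continuous fun p : ℝ × ℝ => a p.1 p.2 := by
  refine Continuous.subtype_mk ?_ _
  refine Continuous.matrix_diagonal ?_
  refine continuous_pi fun i => ?_
  fin_cases i <;> simp <;> fun_prop

/-- The time-one map `x ↦ a₁ x` of the flow. -/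
noncomputable def step (x : X) : X := a 1 0 • x

theorem continuous_step : Continuous step := continuous_const_smul _

theorem iterate_step (n : ℕ) (x : X) : step^[n] x = a n 0 • x := by
  induction n generalizing x with
  | zero => simp [a_zero]
  | succ n ih =>
    rw [Function.iterate_succ_apply, ih, step, ← mul_smul, a_mul_a]
    simp

/-! ### Injectivity of `U`-orbits on compact sets -/

theorem eventually_eq_one_of_mem_Γ : ∀ᶠ g in 𝓝 (1 : G), g ∈ Γ → g = 1 := by
  have h : ∀ i j : Fin 3, ∀ᶠ g in 𝓝 (1 : G), |g i j - (1 : G) i j| < 1 := by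
    intro i j
    have hc : Continuous fun g : G => |g i j - (1 : G) i j| := by
      have : Continuous fun g : G => g i j := continuous_subtype_val.matrix_elem i j
      fun_prop
    exact hc.continuousAt.eventually_lt continuousAt_const (by simp)
  have h' : ∀ᶠ g in 𝓝 (1 : G), ∀ i j, |g i j - (1 : G) i j| < 1 :=
    eventually_all.2 fun i => eventually_all.2 fun j => h i j
  filter_upwards [h'] with g hg hΓ
  obtain ⟨m, rfl⟩ := hΓ
  suffices m = 1 by rw [this, map_one]
  ext i j
  have h1 := hg i j
  have h2 : ((1 : G) : Matrix (Fin 3) (Fin 3) ℝ) i j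
      = (((1 : Matrix (Fin 3) (Fin 3) ℤ) i j : ℤ) : ℝ) := by
    rcases eq_or_ne i j with rfl | hij
    · simp
    · simp [Matrix.one_apply_ne hij]
  rw [h2] at h1
  have h3 : |m.1 i j - (1 : Matrix (Fin 3) (Fin 3) ℤ) i j| < 1 := by
    have : |((m.1 i j : ℤ) : ℝ) - (((1 : Matrix (Fin 3) (Fin 3) ℤ) i j : ℤ) : ℝ)| < 1 := h1
    exact_mod_cast this
  have := Int.abs_lt_one_iff.1 h3
  simpa [sub_eq_zero] using this

/-- `U` acts locally freely near each point of `X`: the stabilizers are conjugates of the discrete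
group `Γ`. -/
theorem eventually_free (x : X) :
    ∀ᶠ p in 𝓝 ((0 : ℝ × ℝ), x), unip p.1 • p.2 = p.2 → p.1 = 0 := by
  obtain ⟨g, rfl⟩ := QuotientGroup.mk_surjective x
  rw [nhds_prod_eq, QuotientGroup.nhds_eq, ← Filter.map_id (f := 𝓝 (0 : ℝ × ℝ)),
    Filter.prod_map_map_eq, Filter.eventually_map, ← nhds_prod_eq]
  have hc : Continuous fun p : (ℝ × ℝ) × G => p.2⁻¹ * (unip p.1 * p.2) :=
    continuous_snd.inv.mul ((continuous_unip.comp continuous_fst).mul continuous_snd)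
  have ht : Tendsto (fun p : (ℝ × ℝ) × G => p.2⁻¹ * (unip p.1 * p.2)) (𝓝 (0, g)) (𝓝 1) := by
    have := hc.tendsto (0, g)
    simpa [unip_zero] using this
  filter_upwards [ht.eventually eventually_eq_one_of_mem_Γ] with p hp h
  have h1 : ((p.2 : G) : X) = ((unip p.1 * p.2 : G) : X) := h.symm
  have h2 := hp (QuotientGroup.eq.1 h1)
  have h3 : unip p.1 * p.2 = p.2 := by
    rw [inv_mul_eq_one] at h2; exact h2.symm
  exact unip_eq_one (by simpa using h3)

/-- On a compact set the radius in which `U` acts freely is uniform. -/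
theorem exists_radius_free {K : Set X} (hK : IsCompact K) :
    ∃ ρ > 0, ∀ v : ℝ × ℝ, ‖v‖ < ρ → ∀ x ∈ K, unip v • x = x → v = 0 := by
  have h := hK.eventually_forall_of_forall_eventually (x₀ := (0 : ℝ × ℝ))
    (P := fun v x => unip v • x = x → v = 0) fun x _ => eventually_free x
  obtain ⟨ρ, hρ, h⟩ := Metric.eventually_nhds_iff.1 h
  exact ⟨ρ, hρ, fun v hv => h (by simpa using hv)⟩

/-- If no `v ≠ 0` with `‖v‖ ≤ R` fixes `x`, then a small neighbourhood of `x` meets an orbit piece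
of size `R` only in a piece of size `r`. -/
theorem exists_nhds_thin {x : X} {r R : ℝ} (hr : 0 < r)
    (hx : ∀ v : ℝ × ℝ, ‖v‖ ≤ R → unip v • x = x → v = 0) :
    ∃ E ∈ 𝓝 x, ∀ y ∈ E, ∀ v : ℝ × ℝ, ‖v‖ ≤ R → unip v • y ∈ E → ‖v‖ ≤ r := by
  -- On the compact annulus `r ≤ ‖v‖ ≤ R`, the image `v x` stays away from `x`.
  set V : Set (ℝ × ℝ) := Metric.closedBall 0 R ∩ {v | r ≤ ‖v‖}
  have hV : IsCompact V :=
    (isCompact_closedBall 0 R).inter_right (isClosed_le continuous_const continuous_norm)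
  have h := hV.eventually_forall_of_forall_eventually (x₀ := (x, x))
    (P := fun p v => unip v • p.1 ≠ p.2) (by
      rintro v ⟨hvR, hvr⟩
      have hc : Continuous fun q : (X × X) × (ℝ × ℝ) => unip q.2 • q.1.1 :=
        (continuous_unip.comp continuous_snd).smul (continuous_fst.comp continuous_fst)
      have hopen : IsOpen {q : (X × X) × (ℝ × ℝ) | unip q.2 • q.1.1 ≠ q.1.2} :=
        isOpen_ne_fun hc (continuous_snd.comp continuous_fst)
      refine hopen.mem_nhds fun h => ?_
      have := hx v (by simpa using hvR) h
      simp only [Set.mem_ofPred_eq] at hvr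
      rw [this, norm_zero] at hvr
      exact absurd hvr (not_le.2 hr))
  rw [nhds_prod_eq] at h
  obtain ⟨E, hE, h⟩ := Filter.mem_prod_self_iff.1 h
  refine ⟨E, hE, fun y hy v hv hvy => ?_⟩
  by_contra hcon
  exact h (Set.mk_mem_prod hy hvy) v ⟨by simpa using hv, (not_le.1 hcon).le⟩ rfl

/-! ### Coverings by sets of bounded diameter -/

/-- `S` is covered by at most `M` sets of diameter at most `r`. -/
def Cov (S : Set (ℝ × ℝ)) (r M : ℝ) : Prop :=
  ∃ t : Finset (Set (ℝ × ℝ)), (t.card : ℝ) ≤ M ∧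
    (∀ B ∈ t, ∀ v ∈ B, ∀ w ∈ B, dist v w ≤ r) ∧ S ⊆ ⋃ B ∈ t, B

namespace Cov

variable {S S' : Set (ℝ × ℝ)} {r M M' : ℝ}

theorem mono_set (h : Cov S r M) (hS : S' ⊆ S) : Cov S' r M := by
  obtain ⟨t, h1, h2, h3⟩ := h
  exact ⟨t, h1, h2, hS.trans h3⟩

theorem mono (h : Cov S r M) (hM : M ≤ M') : Cov S r M' := by
  obtain ⟨t, h1, h2, h3⟩ := h
  exact ⟨t, h1.trans hM, h2, h3⟩

theorem empty (hM : 0 ≤ M) : Cov ∅ r M :=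
  ⟨∅, by simpa using hM, by simp, by simp⟩

theorem single (hS : ∀ v ∈ S, ∀ w ∈ S, dist v w ≤ r) (hM : 1 ≤ M) : Cov S r M :=
  ⟨{S}, by simpa using hM, by simpa using hS, by simp⟩

theorem biUnion {ι : Type*} (I : Finset ι) (S : ι → Set (ℝ × ℝ)) (M : ι → ℝ)
    (h : ∀ i ∈ I, Cov (S i) r (M i)) : Cov (⋃ i ∈ I, S i) r (∑ i ∈ I, M i) := by
  classical
  have h' : ∀ i, ∃ t : Finset (Set (ℝ × ℝ)), i ∈ I → (t.card : ℝ) ≤ M i ∧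
      (∀ B ∈ t, ∀ v ∈ B, ∀ w ∈ B, dist v w ≤ r) ∧ S i ⊆ ⋃ B ∈ t, B := by
    intro i
    by_cases hi : i ∈ I
    · obtain ⟨t, ht⟩ := h i hi
      exact ⟨t, fun _ => ht⟩
    · exact ⟨∅, fun h => absurd h hi⟩
  choose t ht using h'
  refine ⟨I.biUnion t, ?_, ?_, ?_⟩
  · calc ((I.biUnion t).card : ℝ) ≤ ((∑ i ∈ I, (t i).card : ℕ) : ℝ) := by
          exact_mod_cast Finset.card_biUnion_le
      _ = ∑ i ∈ I, ((t i).card : ℝ) := by push_cast; rfl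
      _ ≤ _ := Finset.sum_le_sum fun i hi => (ht i hi).1
  · intro B hB
    obtain ⟨i, hi, hB⟩ := Finset.mem_biUnion.1 hB
    exact (ht i hi).2.1 B hB
  · intro v hv
    simp only [Set.mem_iUnion] at hv
    obtain ⟨i, hi, hv⟩ := hv
    have := (ht i hi).2.2 hv
    simp only [Set.mem_iUnion] at this
    obtain ⟨B, hB, hv⟩ := this
    simp only [Set.mem_iUnion]
    exact ⟨B, Finset.mem_biUnion.2 ⟨i, hi, hB⟩, hv⟩

theorem of_image {D : ℝ × ℝ → ℝ × ℝ} {c : ℝ} (hc : 0 < c)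
    (hD : ∀ v w, c * dist v w ≤ dist (D v) (D w)) (h : Cov (D '' S) r M) :
    Cov S (r / c) M := by
  classical
  obtain ⟨t, h1, h2, h3⟩ := h
  refine ⟨t.image (fun B => D ⁻¹' B), ?_, ?_, ?_⟩
  · exact le_trans (by exact_mod_cast Finset.card_image_le) h1
  · intro B hB v hv w hw
    obtain ⟨B', hB', rfl⟩ := Finset.mem_image.1 hB
    rw [le_div_iff₀ hc, mul_comm]
    exact (hD v w).trans (h2 B' hB' _ hv _ hw)
  · intro v hv
    have := h3 (Set.mem_image_of_mem D hv)
    simp only [Set.mem_iUnion] at this ⊢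
    obtain ⟨B, hB, hv⟩ := this
    exact ⟨_, Finset.mem_image_of_mem _ hB, hv⟩

/-- Cut a box into cells of side `η` and cover the cells one by one. -/
theorem cells {η : ℝ} (hη : 0 < η) (c : ℝ × ℝ) (k l : ℕ)
    (hS : ∀ v ∈ S, |v.1 - c.1| ≤ k * η ∧ |v.2 - c.2| ≤ l * η)
    (h : ∀ B ⊆ S, (∀ v ∈ B, ∀ w ∈ B, dist v w ≤ η) → Cov B r M) :
    Cov S r ((2 * k + 1) * (2 * l + 1) * M) := by
  have hfl : ∀ (x : ℝ) (k : ℕ), |x| ≤ k * η → ⌊x / η⌋ ∈ Finset.Icc (-(k : ℤ)) k := by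
    intro x k hx
    obtain ⟨h1, h2⟩ := abs_le.1 hx
    rw [Finset.mem_Icc]
    constructor
    · rw [Int.le_floor, le_div_iff₀ hη]; push_cast; linarith
    · have : x / η ≤ k := by rw [div_le_iff₀ hη]; exact h2
      have h3 := (Int.floor_le (x / η)).trans this
      exact_mod_cast h3
  have hcell : ∀ x y : ℝ, ⌊x / η⌋ = ⌊y / η⌋ → |x - y| ≤ η := by
    intro x y hxy
    have := Int.abs_sub_lt_one_of_floor_eq_floor hxy
    rw [← sub_div, abs_div, abs_of_pos hη, div_lt_one hη] at this
    exact this.le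
  set I : Finset (ℤ × ℤ) := Finset.Icc (-(k : ℤ)) k ×ˢ Finset.Icc (-(l : ℤ)) l
  have := biUnion (r := r) I
    (fun i => {v ∈ S | ⌊(v.1 - c.1) / η⌋ = i.1 ∧ ⌊(v.2 - c.2) / η⌋ = i.2}) (fun _ => M) (by
      intro i _
      refine h _ (Set.sep_subset _ _) ?_
      rintro v ⟨_, hv1, hv2⟩ w ⟨_, hw1, hw2⟩
      have h1 := hcell _ _ (hv1.trans hw1.symm)
      have h2 := hcell _ _ (hv2.trans hw2.symm)
      rw [sub_sub_sub_cancel_right] at h1 h2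
      rw [Prod.dist_eq, Real.dist_eq, Real.dist_eq]
      exact max_le h1 h2)
  refine (this.mono_set ?_).mono (le_of_eq ?_)
  · intro v hv
    simp only [Set.mem_iUnion]
    exact ⟨(⌊(v.1 - c.1) / η⌋, ⌊(v.2 - c.2) / η⌋),
      Finset.mem_product.2 ⟨hfl _ _ (hS v hv).1, hfl _ _ (hS v hv).2⟩, hv, rfl, rfl⟩
  · have e : ∀ k : ℕ, ((k : ℤ) + 1 + k).toNat = 2 * k + 1 := fun k => by omega
    rw [Finset.sum_const, Finset.card_product, Int.card_Icc, Int.card_Icc, sub_neg_eq_add,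
      sub_neg_eq_add, e, e, nsmul_eq_mul]
    push_cast
    ring

end Cov

/-! ### Coding of orbits -/

variable {Λ : Type*}

/-- The first `N` letters of the itinerary of `y` with respect to the partition `ξ`. -/
noncomputable def word (ξ : X → Λ) (N : ℕ) (y : X) : Fin N → Λ := fun i => ξ (step^[i] y)

theorem word_succ_eq_snoc (ξ : X → Λ) (N : ℕ) (y : X) :
    word ξ (N + 1) y = Fin.snoc (α := fun _ => Λ) (word ξ N y) (ξ (step^[N] y)) := by
  ext i
  refine Fin.lastCases ?_ (fun i => ?_) i
  · simp [word]
  · simp [word]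

theorem word_step (ξ : X → Λ) (N : ℕ) (y : X) :
    word ξ N (step y) = Fin.tail (word ξ (N + 1) y) := by
  ext i
  simp [word, Fin.tail]

theorem step_unip (v : ℝ × ℝ) (y : X) :
    step (unip v • y) = unip (stretch 1 0 v) • step y := by
  simp only [step, ← mul_smul, a_mul_unip]

theorem dist_stretch_le (v w : ℝ × ℝ) : dist (stretch 1 0 v) (stretch 1 0 w) ≤ 8 * dist v w := by
  have h1 := Real.exp_one_lt_d9
  have h2 : Real.exp 2 ≤ 8 := by
    have : Real.exp 2 = Real.exp 1 * Real.exp 1 := by rw [← Real.exp_add]; norm_num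
    rw [this]; nlinarith [Real.exp_pos 1]
  simp only [stretch, Prod.dist_eq, Real.dist_eq, ← mul_sub, abs_mul, Real.abs_exp]
  refine max_le ?_ ?_
  · refine mul_le_mul (by norm_num; linarith) (le_max_left _ _) (abs_nonneg _) (by norm_num)
  · refine mul_le_mul (by norm_num; linarith) (le_max_right _ _) (abs_nonneg _) (by norm_num)

theorem le_dist_stretch {s t c : ℝ} (h1 : c ≤ Real.exp (2 * s + t)) (h2 : c ≤ Real.exp (s + 2 * t))
    (v w : ℝ × ℝ) : c * dist v w ≤ dist (stretch s t v) (stretch s t w) := by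
  simp only [stretch, Prod.dist_eq, Real.dist_eq, ← mul_sub, abs_mul, Real.abs_exp]
  rcases max_cases |v.1 - w.1| |v.2 - w.2| with ⟨h, _⟩ | ⟨h, _⟩ <;> rw [h]
  · exact le_max_of_le_left (mul_le_mul_of_nonneg_right h1 (abs_nonneg _))
  · exact le_max_of_le_right (mul_le_mul_of_nonneg_right h2 (abs_nonneg _))

/-- The cost of a word: the code length of its last letter, and a surcharge if the orbit starts in
the piece `∞` of the partition, where nearby points have to be told apart by hand. -/
noncomputable def cost [DecidableEq Λ] {N : ℕ} (q : (Fin (N + 1) → Λ) → ℝ) (bad : Λ)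
    (w : Fin (N + 1) → Λ) : ℝ :=
  -Real.log (q w) + if w 0 = bad then 6 else 0

/-- The surcharge `6` pays for cutting a set of diameter `8η` into `17 * 17` cells of side `η`. -/
theorem exp_six_ge : (289 : ℝ) ≤ Real.exp 6 := by
  have h1 := Real.exp_one_gt_d9
  have : Real.exp 6 = Real.exp 1 ^ 6 := by rw [← Real.exp_nat_mul]; norm_num
  rw [this]
  calc (289 : ℝ) ≤ 2.7 ^ 6 := by norm_num
    _ ≤ _ := by gcongr; linarith

/-- If `q` is a conditional code for the next letter of itineraries, then points on which the sum of
the costs is at most `E` are covered by `e^E` sets, by induction on `n`: the points are split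
according to their next letter, and Kraft's inequality `hsum` adds up the bounds for the parts.
By `hthin` a part has diameter at most `η` already, unless the orbit starts in `bad`. The step
stretches distances by at most `8` and at least `e`. -/
theorem cov_of_cost [Fintype Λ] [DecidableEq Λ] {ξ : X → Λ} {bad : Λ} {N : ℕ}
    {q : (Fin (N + 1) → Λ) → ℝ} (hq : ∀ w, 0 < q w)
    (hsum : ∀ w : Fin N → Λ, ∑ l, q (Fin.snoc (α := fun _ => Λ) w l) ≤ 1) {η : ℝ} (hη : 0 < η)
    (hthin : ∀ (y : X) (v : ℝ × ℝ), ‖v‖ ≤ 8 * η → ξ (unip v • y) = ξ y → ξ y ≠ bad → ‖v‖ ≤ η)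
    (n : ℕ) : ∀ (y : X) (E : ℝ) (w : Fin N → Λ) (S : Set (ℝ × ℝ)),
      (∀ v ∈ S, ∀ v' ∈ S, dist v v' ≤ 8 * η) → (∀ v ∈ S, word ξ N (unip v • y) = w) →
      (∀ v ∈ S, ∑ j ∈ Finset.range n, cost q bad (word ξ (N + 1) (step^[j] (unip v • y))) ≤ E) →
      Cov S (8 * η * Real.exp (-n)) (Real.exp E) := by
  induction n with
  | zero =>
    intro y E w S hS _ hE
    rcases S.eq_empty_or_nonempty with rfl | ⟨v, hv⟩
    · exact Cov.empty (Real.exp_pos _).le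
    · have := hE v hv
      rw [Finset.sum_range_zero] at this
      exact Cov.single (by simpa using hS) (Real.one_le_exp this)
  | succ n ih =>
    intro y E w S hS hw hE
    set Sl : Λ → Set (ℝ × ℝ) := fun l => {v ∈ S | ξ (step^[N] (unip v • y)) = l} with hSl
    suffices h : ∀ l ∈ Finset.univ, Cov (Sl l) (8 * η * Real.exp (-(n + 1 : ℕ)))
        (q (Fin.snoc (α := fun _ => Λ) w l) * Real.exp E) by
      refine ((Cov.biUnion _ _ _ h).mono_set ?_).mono ?_
      · intro v hv
        simp only [Set.mem_iUnion]
        exact ⟨_, Finset.mem_univ _, hv, rfl⟩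
      · rw [← Finset.sum_mul]
        exact mul_le_of_le_one_left (Real.exp_pos _).le (hsum w)
    intro l _
    set w1 : Fin (N + 1) → Λ := Fin.snoc (α := fun _ => Λ) w l with hw1
    have hword : ∀ v ∈ Sl l, word ξ (N + 1) (unip v • y) = w1 := by
      rintro v ⟨hv, hvl⟩
      rw [word_succ_eq_snoc, hw v hv, hvl]
    have hfirst : ∀ v ∈ Sl l, ξ (unip v • y) = w1 0 := by
      intro v hv
      rw [← hword v hv]; rfl
    have key : ∀ B ⊆ Sl l, (∀ v ∈ B, ∀ v' ∈ B, dist v v' ≤ η) →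
        Cov B (8 * η * Real.exp (-(n + 1 : ℕ))) (Real.exp (E - cost q bad w1)) := by
      intro B hB hBd
      have := ih (step y) (E - cost q bad w1) (Fin.tail w1) (stretch 1 0 '' B) ?_ ?_ ?_
      · have h2 := Cov.of_image (Real.exp_pos 1)
          (le_dist_stretch (s := 1) (t := 0) (by simp) (by simp)) this
        convert h2 using 1
        rw [mul_div_assoc, ← Real.exp_sub]
        push_cast
        ring_nf
      · rintro _ ⟨v, hv, rfl⟩ _ ⟨v', hv', rfl⟩
        exact (dist_stretch_le v v').trans (by have := hBd v hv v' hv'; linarith)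
      · rintro _ ⟨v, hv, rfl⟩
        rw [← step_unip, word_step, hword v (hB hv)]
      · rintro _ ⟨v, hv, rfl⟩
        have h1 := hE v (hB hv).1
        rw [Finset.sum_range_succ'] at h1
        simp only [Function.iterate_succ_apply, Function.iterate_zero, id_eq] at h1
        rw [hword v (hB hv), step_unip] at h1
        linarith
    by_cases hbad : w1 0 = bad
    · rcases (Sl l).eq_empty_or_nonempty with h0 | ⟨v₀, hv₀⟩
      · rw [h0]
        exact Cov.empty (mul_pos (hq _) (Real.exp_pos _)).le
      · refine (Cov.cells hη v₀ 8 8 ?_ key).mono ?_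
        · intro v hv
          have h := hS v hv.1 v₀ hv₀.1
          rw [Prod.dist_eq, Real.dist_eq, Real.dist_eq] at h
          push_cast
          exact ⟨(le_max_left _ _).trans h, (le_max_right _ _).trans h⟩
        · rw [cost, if_pos hbad, show E - (-Real.log (q w1) + 6) = Real.log (q w1) + E - 6 by ring,
            Real.exp_sub, Real.exp_add, Real.exp_log (hq _)]
          push_cast
          have h6 := exp_six_ge
          have hp := mul_pos (hq w1) (Real.exp_pos E)
          rw [mul_div_assoc', div_le_iff₀ (Real.exp_pos 6)]
          nlinarith
    · refine (key _ subset_rfl ?_).mono ?_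
      · intro v hv v' hv'
        have h := hS v hv.1 v' hv'.1
        rw [dist_eq_norm] at h ⊢
        refine hthin (unip v' • y) (v - v') h ?_ ?_
        · rw [← mul_smul, ← unip_add, sub_add_cancel, hfirst v hv, hfirst v' hv']
        · rw [hfirst v' hv']; exact hbad
      · rw [cost, if_neg hbad, add_zero, sub_neg_eq_add, Real.exp_add,
          Real.exp_log (hq _), mul_comm]

/-- A cost function on `X` is a coding cost if orbit pieces along which its sum is at most `E` are
described, up to the Bowen distance of the flow, by `O(e^E)` code words. -/
def IsCodingCost (g : X → ℝ) : Prop :=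
  ∃ η > 0, η ≤ 1 ∧ ∃ C > 0, ∀ (n : ℕ) (y : X) (E : ℝ) (S : Set (ℝ × ℝ)),
    (∀ v ∈ S, ∀ v' ∈ S, dist v v' ≤ η) →
    (∀ v ∈ S, ∑ j ∈ Finset.range n, g (step^[j] (unip v • y)) ≤ E) →
    Cov S (8 * Real.exp (-n)) (C * Real.exp E)

theorem IsCodingCost.mono {g g' : X → ℝ} (h : IsCodingCost g) (hg : ∀ y, g y ≤ g' y) :
    IsCodingCost g' := by
  obtain ⟨η, hη, hη1, C, hC, h⟩ := h
  exact ⟨η, hη, hη1, C, hC, fun n y E S hS hE =>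
    h n y E S hS fun v hv => (Finset.sum_le_sum fun _ _ => hg _).trans (hE v hv)⟩

/-- The cost of a conditional code is a coding cost; the constant is the number of words of
length `N`, which are the possible states at the start. -/
theorem isCodingCost_cost [Fintype Λ] [DecidableEq Λ] {ξ : X → Λ} {bad : Λ} {N : ℕ}
    {q : (Fin (N + 1) → Λ) → ℝ} (hq : ∀ w, 0 < q w)
    (hsum : ∀ w : Fin N → Λ, ∑ l, q (Fin.snoc (α := fun _ => Λ) w l) ≤ 1) {η : ℝ} (hη : 0 < η)
    (hη1 : η ≤ 1)
    (hthin : ∀ (y : X) (v : ℝ × ℝ), ‖v‖ ≤ 8 * η → ξ (unip v • y) = ξ y → ξ y ≠ bad → ‖v‖ ≤ η) :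
    IsCodingCost fun y => cost q bad (word ξ (N + 1) y) := by
  refine ⟨η, hη, hη1, Fintype.card (Fin N → Λ) + 1, by positivity, fun n y E S hS hE => ?_⟩
  have := Cov.biUnion (r := 8 * Real.exp (-n)) Finset.univ
    (fun w : Fin N → Λ => {v ∈ S | word ξ N (unip v • y) = w}) (fun _ => Real.exp E) (by
      intro w _
      obtain ⟨t, h1, h2, h3⟩ := cov_of_cost hq hsum hη hthin n y E w
        {v ∈ S | word ξ N (unip v • y) = w} (fun v hv v' hv' => by
          have := hS v hv.1 v' hv'.1; linarith) (fun v hv => hv.2) fun v hv => hE v hv.1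
      refine ⟨t, h1, fun B hB v hv w hw => (h2 B hB v hv w hw).trans ?_, h3⟩
      have := Real.exp_pos (-n)
      nlinarith)
  refine (this.mono_set ?_).mono ?_
  · intro v hv
    simp only [Set.mem_iUnion]
    exact ⟨_, Finset.mem_univ _, hv, rfl⟩
  · rw [Finset.sum_const, nsmul_eq_mul, Finset.card_univ]
    have := Real.exp_pos E
    nlinarith

/-! ### Continuous approximation of step functions -/

section Majorant

variable {Y : Type*} [TopologicalSpace Y] [MeasurableSpace Y] {μ : Measure Y} [IsFiniteMeasure μ]

theorem integral_bump_le {φ : C(Y, ℝ)} {V : Set Y} (hV : MeasurableSet V) (hφV : tsupport φ ⊆ V)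
    (hφ : ∀ x, φ x ∈ Set.Icc (0 : ℝ) 1) : ∫ x, φ x ∂μ ≤ μ.real V := by
  rw [← integral_indicator_one hV]
  refine integral_mono_of_nonneg (ae_of_all _ fun x => (hφ x).1)
    ((integrable_const (1 : ℝ)).indicator hV) (ae_of_all _ fun x => ?_)
  by_cases hx : x ∈ V
  · simpa [hx] using (hφ x).2
  · simp [hx, image_eq_zero_of_notMem_tsupport fun h => hx (hφV h)]

theorem le_integral_bump [BorelSpace Y] {φ : C(Y, ℝ)} {C : Set Y} (hC : MeasurableSet C)
    (hφC : Set.EqOn φ 1 C)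
    (hφ : ∀ x, φ x ∈ Set.Icc (0 : ℝ) 1) : μ.real C ≤ ∫ x, φ x ∂μ := by
  rw [← integral_indicator_one hC]
  refine integral_mono_of_nonneg (ae_of_all _ fun x => Set.indicator_nonneg (by simp) x)
    (Integrable.of_bound φ.continuous.aestronglyMeasurable 1
      (ae_of_all _ fun x => ?_)) (ae_of_all _ fun x => ?_)
  · rw [Real.norm_eq_abs, abs_of_nonneg (hφ x).1]; exact (hφ x).2
  · by_cases hx : x ∈ C
    · simp [hx, hφC hx]
    · simpa [hx] using (hφ x).1

variable [T2Space Y] [LocallyCompactSpace Y] [BorelSpace Y] [μ.Regular]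

theorem exists_bump_ge {C : Set Y} (hC : IsCompact C) {δ : ℝ} (hδ : 0 < δ) :
    ∃ φ : C(Y, ℝ), HasCompactSupport φ ∧ (∀ x, φ x ∈ Set.Icc (0 : ℝ) 1) ∧ Set.EqOn φ 1 C ∧
      ∫ x, φ x ∂μ ≤ μ.real C + δ := by
  obtain ⟨V, hCV, hV, hμ⟩ := C.exists_isOpen_lt_add (measure_ne_top μ C)
    (ENNReal.ofReal_pos.2 hδ).ne'
  obtain ⟨φ, h1, h2, h3, h4⟩ := exists_continuousMap_one_of_isCompact_subset_isOpen hC hV hCV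
  refine ⟨φ, h2, h4, h1, (integral_bump_le hV.measurableSet h3 h4).trans ?_⟩
  have := ENNReal.toReal_mono (by finiteness) hμ.le
  rwa [ENNReal.toReal_add (by finiteness) (by finiteness), ENNReal.toReal_ofReal hδ.le] at this

theorem exists_bump_le {V : Set Y} (hV : IsOpen V) {δ : ℝ} (hδ : 0 < δ) :
    ∃ φ : C(Y, ℝ), HasCompactSupport φ ∧ (∀ x, φ x ∈ Set.Icc (0 : ℝ) 1) ∧
      (∀ x ∉ V, φ x = 0) ∧ μ.real V - δ ≤ ∫ x, φ x ∂μ := by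
  obtain ⟨C, hCV, hC, hμ⟩ := hV.measurableSet.exists_isCompact_lt_add (measure_ne_top μ V)
    (ENNReal.ofReal_pos.2 hδ).ne'
  obtain ⟨φ, h1, h2, h3, h4⟩ := exists_continuousMap_one_of_isCompact_subset_isOpen hC hV hCV
  refine ⟨φ, h2, h4, fun x hx => image_eq_zero_of_notMem_tsupport fun h => hx (h3 h), ?_⟩
  refine le_trans ?_ (le_integral_bump hC.measurableSet h1 h4)
  have := ENNReal.toReal_mono (by finiteness) hμ.le
  rw [ENNReal.toReal_add (by finiteness) (by finiteness), ENNReal.toReal_ofReal hδ.le] at this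
  rw [sub_le_iff_le_add]
  exact this

/-- A step function whose pieces have null boundary, and which is constant off a compact set, has
continuous majorants of almost the same integral. The mass `1 - μ(Y)` is thought of as sitting at
infinity. -/
theorem exists_continuous_majorant {W : Type*} [Fintype W] [DecidableEq W] {σ : Y → W} {w₀ : W}
    (hσ : ∀ w, MeasurableSet (σ ⁻¹' {w})) {K : Set Y} (hK : IsCompact K)
    (hσK : ∀ y ∉ K, σ y = w₀) (hloc : ∀ᵐ y ∂μ, ∀ᶠ z in 𝓝 y, σ z = σ y)
    {c : W → ℝ} (hc : ∀ w, 0 ≤ c w) {ε : ℝ} (hε : 0 < ε) :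
    ∃ (φ : C(Y, ℝ)) (κ : ℝ), HasCompactSupport φ ∧ (∀ y, c (σ y) ≤ φ y + κ) ∧
      ∫ y, φ y ∂μ + κ ≤
        ∑ w, c w * (μ.real (σ ⁻¹' {w}) + if w = w₀ then 1 - μ.real Set.univ else 0) + ε := by
  have hsum : 0 ≤ ∑ w, c w := Finset.sum_nonneg fun w _ => hc w
  obtain ⟨δ, hδ, hδε⟩ : ∃ δ > 0, δ * ∑ w, c w ≤ ε := by
    refine ⟨ε / (∑ w, c w + 1), by positivity, ?_⟩
    rw [div_mul_eq_mul_div, div_le_iff₀ (by positivity)]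
    nlinarith
  have hcl : ∀ w, w ≠ w₀ → IsCompact (closure (σ ⁻¹' {w})) := fun w hw => by
    refine hK.closure_of_subset fun y hy => ?_
    by_contra h
    exact hw ((Set.mem_singleton_iff.1 hy).symm.trans (hσK y h))
  have hclμ : ∀ w, μ.real (closure (σ ⁻¹' {w})) = μ.real (σ ⁻¹' {w}) := by
    intro w
    refine measureReal_congr ?_
    refine Filter.EventuallyLE.antisymm ?_ subset_closure.eventuallyLE
    filter_upwards [hloc] with y hy hyc
    obtain ⟨z, hz1, hz2⟩ := ((mem_closure_iff_frequently.1 hyc).and_eventually hy).exists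
    exact hz2.symm.trans hz1
  have hint : μ.real (interior (σ ⁻¹' {w₀})ᶜ) = μ.real (σ ⁻¹' {w₀})ᶜ := by
    refine measureReal_congr (interior_subset.eventuallyLE.antisymm ?_)
    filter_upwards [hloc] with y hy hyc
    refine mem_interior_iff_mem_nhds.2 ?_
    filter_upwards [hy] with z hz
    exact fun h : σ z = w₀ => hyc (hz.symm.trans h)
  choose! g hg1 hg2 hg3 hg4 using fun w (hw : w ≠ w₀) => exists_bump_ge (μ := μ) (hcl w hw) hδ
  obtain ⟨h, hh1, hh2, hh3, hh4⟩ := exists_bump_le (μ := μ)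
    (isOpen_interior (s := (σ ⁻¹' {w₀})ᶜ)) hδ
  rw [hint, measureReal_compl (hσ w₀)] at hh4
  have hbd : ∀ φ : C(Y, ℝ), (∀ x, φ x ∈ Set.Icc (0 : ℝ) 1) → Integrable φ μ := fun φ hφ =>
    Integrable.of_bound φ.continuous.aestronglyMeasurable 1 (ae_of_all _ fun x => by
      rw [Real.norm_eq_abs, abs_of_nonneg (hφ x).1]; exact (hφ x).2)
  refine ⟨∑ w ∈ Finset.univ.erase w₀, c w • g w - c w₀ • h, c w₀, ?_, ?_, ?_⟩
  · have e : ⇑(∑ w ∈ Finset.univ.erase w₀, c w • g w - c w₀ • h) =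
        fun y => ∑ w ∈ Finset.univ.erase w₀, c w * g w y - c w₀ * h y := by
      ext y; simp
    rw [e]
    have hC : IsCompact ((⋃ w ∈ Finset.univ.erase w₀, tsupport (g w)) ∪ tsupport h) := by
      refine IsCompact.union ?_ hh1
      exact (Finset.univ.erase w₀).isCompact_biUnion fun w hw => hg1 w (Finset.ne_of_mem_erase hw)
    refine HasCompactSupport.intro hC fun y hy => ?_
    rw [Set.mem_union, not_or, Set.mem_iUnion₂] at hy
    rw [image_eq_zero_of_notMem_tsupport hy.2, mul_zero, sub_zero]
    refine Finset.sum_eq_zero fun w hw => ?_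
    rw [image_eq_zero_of_notMem_tsupport fun hyw => hy.1 ⟨w, hw, hyw⟩, mul_zero]
  · intro y
    have e : (∑ w ∈ Finset.univ.erase w₀, c w • g w - c w₀ • h) y =
        ∑ w ∈ Finset.univ.erase w₀, c w * g w y - c w₀ * h y := by simp
    rw [e]
    have hnn : ∀ w ∈ Finset.univ.erase w₀, 0 ≤ c w * g w y := fun w hw =>
      mul_nonneg (hc w) (hg2 w (Finset.ne_of_mem_erase hw) y).1
    by_cases hy : σ y = w₀
    · have h0 : h y = 0 := hh3 y fun hi => interior_subset hi hy
      have := Finset.sum_nonneg hnn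
      rw [h0, hy]; linarith
    · have h1 := Finset.single_le_sum hnn (Finset.mem_erase.2 ⟨hy, Finset.mem_univ (σ y)⟩)
      have h2 : g (σ y) y = 1 := hg3 (σ y) hy (subset_closure rfl)
      rw [h2, mul_one] at h1
      have := mul_le_mul_of_nonneg_left (hh2 y).2 (hc w₀)
      linarith
  · have e : ∫ y, (∑ w ∈ Finset.univ.erase w₀, c w • g w - c w₀ • h) y ∂μ =
        ∑ w ∈ Finset.univ.erase w₀, c w * ∫ y, g w y ∂μ - c w₀ * ∫ y, h y ∂μ := by
      simp only [ContinuousMap.sub_apply, ContinuousMap.coe_sum, Finset.sum_apply,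
        ContinuousMap.smul_apply, smul_eq_mul]
      have hi : ∀ w ∈ Finset.univ.erase w₀, Integrable (fun y => c w * g w y) μ := fun w hw =>
        (hbd _ (hg2 w (Finset.ne_of_mem_erase hw))).const_mul _
      rw [integral_sub (integrable_finsetSum _ hi) ((hbd h hh2).const_mul _),
        integral_finsetSum _ hi]
      simp only [integral_const_mul]
    rw [e]
    have h1 : ∑ w ∈ Finset.univ.erase w₀, c w * ∫ y, g w y ∂μ ≤
        ∑ w ∈ Finset.univ.erase w₀, (c w * (μ.real (σ ⁻¹' {w}) +
          if w = w₀ then 1 - μ.real Set.univ else 0) + δ * c w) := by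
      refine Finset.sum_le_sum fun w hw => ?_
      have hw := Finset.ne_of_mem_erase hw
      have := mul_le_mul_of_nonneg_left (hg4 w hw) (hc w)
      rw [hclμ] at this
      rw [if_neg hw]
      linarith
    have h2 := mul_le_mul_of_nonneg_left hh4 (hc w₀)
    have h3 := Finset.add_sum_erase Finset.univ (fun w => c w * (μ.real (σ ⁻¹' {w}) +
          if w = w₀ then 1 - μ.real Set.univ else 0) + δ * c w) (Finset.mem_univ w₀)
    simp only [if_true] at h3
    simp only [Finset.sum_add_distrib, ← Finset.mul_sum] at h1 h3
    linarith

end Majorant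

/-! ### Partitions into small pieces -/

/-- For every finite measure `μ` on `X` there are finite partitions with `μ`-null boundaries, one
piece of which (`bad`) has small mass and contains the complement of a compact set, while each of
the others meets a piece of a `U`-orbit of size `8η` only in a piece of size `η`. -/
theorem exists_partition (μ : Measure X) [IsFiniteMeasure μ] {ε : ℝ} (hε : 0 < ε) :
    ∃ η > 0, η ≤ 1 ∧ ∃ (k : ℕ) (ξ : X → Fin k) (bad : Fin k), Measurable ξ ∧
      μ.real (ξ ⁻¹' {bad}) ≤ ε ∧ (∃ K : Set X, IsCompact K ∧ ∀ y ∉ K, ξ y = bad) ∧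
      (∀ᵐ y ∂μ, ∀ᶠ z in 𝓝 y, ξ z = ξ y) ∧
      ∀ (y : X) (v : ℝ × ℝ), ‖v‖ ≤ 8 * η → ξ (unip v • y) = ξ y → ξ y ≠ bad → ‖v‖ ≤ η := by
  classical
  obtain ⟨K, -, hK, hKμ⟩ := (MeasurableSet.univ (α := X)).exists_isCompact_sdiff_lt
    (measure_ne_top μ _) (ENNReal.ofReal_pos.2 hε).ne'
  obtain ⟨ρ, hρ, hfree⟩ := exists_radius_free hK
  obtain ⟨η, hη, hη1, hηρ⟩ : ∃ η > 0, η ≤ 1 ∧ 8 * η < ρ :=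
    ⟨min 1 (ρ / 16), by positivity, min_le_left _ _, by
      have := min_le_right 1 (ρ / 16); linarith⟩
  have hE : ∀ x ∈ K, ∃ E ∈ 𝓝 x, ∀ y ∈ E, ∀ v : ℝ × ℝ, ‖v‖ ≤ 8 * η → unip v • y ∈ E → ‖v‖ ≤ η :=
    fun x hx => exists_nhds_thin hη fun v hv => hfree v (hv.trans_lt hηρ) x hx
  choose! E hEx hEthin using hE
  have hf : ∀ x ∈ K, ∃ f : C(X, ℝ), f x = 1 ∧ HasCompactSupport f ∧ tsupport f ⊆ E x := by
    intro x hx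
    obtain ⟨f, h1, h2, h3, -⟩ := exists_continuousMap_one_of_isCompact_subset_isOpen
      (isCompact_singleton (x := x)) (isOpen_interior (s := E x))
      (Set.singleton_subset_iff.2 (mem_interior_iff_mem_nhds.2 (hEx x hx)))
    exact ⟨f, h1 rfl, h2, h3.trans interior_subset⟩
  choose! f hf1 hf2 hf3 using hf
  obtain ⟨t, htK, htc⟩ := hK.elim_nhds_subcover (fun x => {y | 1 / 2 < f x y}) (fun x hx =>
    (f x).continuous.continuousAt.eventually (lt_mem_nhds (by rw [hf1 x hx]; norm_num)))
  obtain ⟨r, hrt, hr0, hr1⟩ : ∃ r : ℝ, (∀ x ∈ t, μ {y | f x y = r} = 0) ∧ 0 < r ∧ r < 1 / 2 := by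
    have hc : (⋃ x ∈ t, {r : ℝ | 0 < μ {y | f x y = r}}).Countable :=
      t.countable_toSet.biUnion fun x _ =>
        Measure.countable_meas_level_set_pos (f x).continuous.measurable
    obtain ⟨r, hr, hr0, hr1⟩ := (hc.dense_compl ℝ).exists_between (show (0 : ℝ) < 1 / 2 by norm_num)
    refine ⟨r, fun x hx => ?_, hr0, hr1⟩
    by_contra h
    exact hr (Set.mem_biUnion (show x ∈ (t : Set X) from hx) (pos_iff_ne_zero.2 h))
  -- A piece is determined by the set of the bump functions that exceed `r` on it.
  let ξ₀ : X → (t → Bool) := fun y x => decide (r < f x y)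
  let e := Fintype.equivFin (t → Bool)
  have hξ₀ : Measurable ξ₀ := by
    refine measurable_pi_iff.2 fun x => measurable_to_bool ?_
    have : (fun y => ξ₀ y x) ⁻¹' {true} = {y | r < f x y} := by ext y; simp [ξ₀]
    rw [this]
    exact (isOpen_lt continuous_const (f x).continuous).measurableSet
  have hbad : ∀ y, (e (ξ₀ y) = e fun _ => false) ↔ ∀ x ∈ t, f x y ≤ r := by
    intro y
    rw [e.apply_eq_iff_eq, funext_iff]
    simp [ξ₀]
  refine ⟨η, hη, hη1, _, fun y => e (ξ₀ y), e fun _ => false, (measurable_of_finite e).comp hξ₀,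
    ?_, ⟨⋃ x ∈ t, tsupport (f x), ?_, ?_⟩, ?_, ?_⟩
  · have : (fun y => e (ξ₀ y)) ⁻¹' {e fun _ => false} ⊆ Set.univ \ K := by
      intro y hy
      refine ⟨trivial, fun hyK => ?_⟩
      obtain ⟨x, hx, hxy⟩ := Set.mem_iUnion₂.1 (htc hyK)
      have h1 := (hbad y).1 hy x hx
      have h2 : 1 / 2 < f x y := hxy
      linarith
    exact ENNReal.toReal_le_of_le_ofReal hε.le ((measure_mono this).trans hKμ.le)
  · exact t.isCompact_biUnion fun x hx => hf2 x (htK x hx)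
  · intro y hy
    rw [hbad]
    intro x hx
    rw [image_eq_zero_of_notMem_tsupport fun h => hy (Set.mem_biUnion hx h)]
    exact hr0.le
  · have : ∀ᵐ y ∂μ, ∀ x : t, f x y ≠ r := ae_all_iff.2 fun x => by
      rw [ae_iff]; simpa using hrt x x.2
    filter_upwards [this] with y hy
    have : ∀ᶠ z in 𝓝 y, ∀ x : t, (r < f x z ↔ r < f x y) := by
      refine eventually_all.2 fun x => ?_
      rcases (hy x).lt_or_gt with h | h
      · filter_upwards [(f x).continuous.continuousAt.eventually (gt_mem_nhds h)] with z hz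
        exact iff_of_false (not_lt.2 (le_of_lt hz)) (not_lt.2 h.le)
      · filter_upwards [(f x).continuous.continuousAt.eventually (lt_mem_nhds h)] with z hz
        exact iff_of_true hz h
    filter_upwards [this] with z hz
    congr 1
    ext x
    simp [ξ₀, hz x]
  · intro y v hv hξ hy
    rw [Ne, hbad] at hy
    push Not at hy
    obtain ⟨x, hx, hxy⟩ := hy
    have hxv : r < f x (unip v • y) := by
      have := congrFun (e.injective hξ) ⟨x, hx⟩
      simpa [ξ₀, hxy] using this
    have hmem : ∀ z, r < f x z → z ∈ E x := fun z hz => by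
      by_contra h
      rw [image_eq_zero_of_notMem_tsupport fun h' => h (hf3 x (htK x hx) h')] at hz
      linarith
    exact hEthin x (htK x hx) y (hmem y hxy) v hv (hmem _ hxv)

/-! ### Codes of small mean length -/

section Code

variable {Λ : Type*} [Fintype Λ]

theorem sum_word_succ {N : ℕ} (f : (Fin (N + 1) → Λ) → ℝ) :
    ∑ w, f w = ∑ w : Fin N → Λ, ∑ l, f (Fin.snoc (α := fun _ => Λ) w l) := by
  rw [← (Fin.snocEquiv fun _ : Fin (N + 1) => Λ).sum_comp f, Fintype.sum_prod_type_right]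
  rfl

/-- A distribution `p` on words has a positive conditional code `q` for the last letter whose mean
code length is the conditional entropy of the last letter, up to `ε`. -/
theorem exists_code [Nonempty Λ] {N : ℕ} {p : (Fin (N + 1) → Λ) → ℝ} (hp : ∀ w, 0 ≤ p w)
    (hp1 : ∑ w, p w = 1) {ε : ℝ} (hε : 0 < ε) :
    ∃ q : (Fin (N + 1) → Λ) → ℝ, (∀ w, 0 < q w) ∧
      (∀ w : Fin N → Λ, ∑ l, q (Fin.snoc (α := fun _ => Λ) w l) ≤ 1) ∧
      ∑ w, p w * -Real.log (q w) ≤ ∑ w, Real.negMulLog (p w) -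
        ∑ w : Fin N → Λ, Real.negMulLog (∑ l, p (Fin.snoc (α := fun _ => Λ) w l)) + ε := by
  set P : (Fin N → Λ) → ℝ := fun w => ∑ l, p (Fin.snoc (α := fun _ => Λ) w l) with hP
  have hP0 : ∀ w, 0 ≤ P w := fun w => Finset.sum_nonneg fun l _ => hp _
  have hpP : ∀ w : Fin (N + 1) → Λ, p w ≤ P (Fin.init w) := fun w => by
    have := Finset.single_le_sum (f := fun l => p (Fin.snoc (α := fun _ => Λ) (Fin.init w) l))
      (fun l _ => hp _) (Finset.mem_univ (w (Fin.last N)))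
    simpa only [Fin.snoc_init_self] using this
  have hcard : (0 : ℝ) < Fintype.card Λ := by exact_mod_cast Fintype.card_pos
  have hexp : Real.exp (-ε) < 1 := by
    rw [← Real.exp_zero]; exact Real.exp_lt_exp.2 (by linarith)
  -- Mixing with the uniform distribution keeps all code lengths finite.
  set q : (Fin (N + 1) → Λ) → ℝ := fun w =>
    Real.exp (-ε) * (p w / P (Fin.init w)) + (1 - Real.exp (-ε)) / Fintype.card Λ with hq
  have hq0 : 0 < (1 - Real.exp (-ε)) / Fintype.card Λ := div_pos (by linarith) hcard
  have hq1 : ∀ w, 0 ≤ Real.exp (-ε) * (p w / P (Fin.init w)) := fun w =>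
    mul_nonneg (Real.exp_pos _).le (div_nonneg (hp w) (hP0 _))
  refine ⟨q, fun w => add_pos_of_nonneg_of_pos (hq1 w) hq0, fun w => ?_, ?_⟩
  · simp only [hq, Fin.init_snoc, Finset.sum_add_distrib, ← Finset.mul_sum, ← Finset.sum_div,
      Finset.sum_const, Finset.card_univ, nsmul_eq_mul]
    rw [mul_div_cancel_left₀ _ hcard.ne']
    have : Real.exp (-ε) * (P w / P w) ≤ Real.exp (-ε) :=
      mul_le_of_le_one_right (Real.exp_pos _).le (div_self_le_one _)
    linarith
  · have hterm : ∀ w, p w * -Real.log (q w) ≤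
        Real.negMulLog (p w) + p w * Real.log (P (Fin.init w)) + p w * ε := by
      intro w
      rcases (hp w).eq_or_lt with h0 | h0
      · simp [← h0]
      · have hPw := h0.trans_le (hpP w)
        have h1 : Real.exp (-ε) * (p w / P (Fin.init w)) ≤ q w := le_add_of_nonneg_right hq0.le
        have h2 := Real.log_le_log (by positivity) h1
        rw [Real.log_mul (Real.exp_pos _).ne' (by positivity), Real.log_exp,
          Real.log_div h0.ne' hPw.ne'] at h2
        rw [Real.negMulLog]
        nlinarith
    have hsum : ∑ w, p w * Real.log (P (Fin.init w)) = -∑ w, Real.negMulLog (P w) := by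
      rw [sum_word_succ, ← Finset.sum_neg_distrib]
      refine Finset.sum_congr rfl fun w _ => ?_
      simp only [Fin.init_snoc]
      rw [← Finset.sum_mul, Real.negMulLog, neg_mul, neg_neg]
    have := Finset.sum_le_sum fun w (_ : w ∈ Finset.univ) => hterm w
    simp only [Finset.sum_add_distrib] at this
    rw [hsum, ← Finset.sum_mul, hp1] at this
    linarith

theorem negMulLog_le_one {x : ℝ} (hx : 0 ≤ x) : Real.negMulLog x ≤ 1 := by
  rcases hx.eq_or_lt with rfl | hx
  · simp
  · have h := mul_le_mul_of_nonneg_left (Real.one_sub_inv_le_log_of_pos hx) hx.le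
    rw [mul_sub, mul_inv_cancel₀ hx.ne'] at h
    rw [Real.negMulLog]
    linarith

theorem negMulLog_add_le {x y : ℝ} (hx : 0 ≤ x) (hy : 0 ≤ y) :
    Real.negMulLog (x + y) ≤ Real.negMulLog x + Real.negMulLog y := by
  have key : ∀ {x y : ℝ}, 0 ≤ x → 0 ≤ y → x * Real.log x ≤ x * Real.log (x + y) := by
    intro x y hx hy
    rcases hx.eq_or_lt with rfl | hx
    · simp
    · exact mul_le_mul_of_nonneg_left (Real.log_le_log hx (by linarith)) hx.le
  have h1 := key hx hy
  have h2 := key hy hx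
  rw [add_comm y x] at h2
  simp only [Real.negMulLog]
  linarith

end Code

section WordLaw

variable {k : ℕ} {ξ : X → Fin k}

theorem measurable_word (hξ : Measurable ξ) (n : ℕ) : Measurable (word ξ n) :=
  measurable_pi_iff.2 fun i => hξ.comp (continuous_step.iterate i).measurable

/-- The law of the words of length `n` under `μ`, where the missing mass `1 - μ(X)` sits on the
word all of whose letters are `bad`. -/
noncomputable def wordLaw (μ : Measure X) (ξ : X → Fin k) (bad : Fin k) (n : ℕ)
    (w : Fin n → Fin k) : ℝ :=
  μ.real (word ξ n ⁻¹' {w}) + if w = (fun _ => bad) then 1 - μ.real Set.univ else 0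

variable {μ : Measure X} {bad : Fin k}

theorem wordLaw_nonneg (hμ : μ.real Set.univ ≤ 1) (n : ℕ) (w : Fin n → Fin k) :
    0 ≤ wordLaw μ ξ bad n w := by
  refine add_nonneg measureReal_nonneg ?_
  split_ifs <;> linarith

variable [IsFiniteMeasure μ]

theorem sum_word_measure (hξ : Measurable ξ) (n : ℕ) :
    ∑ w, μ.real (word ξ n ⁻¹' {w}) = μ.real Set.univ := by
  rw [sum_measureReal_preimage_singleton _ fun w _ =>
    measurable_word hξ n (MeasurableSet.singleton w)]
  simp

theorem sum_wordLaw (hξ : Measurable ξ) (n : ℕ) : ∑ w, wordLaw μ ξ bad n w = 1 := by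
  simp only [wordLaw, Finset.sum_add_distrib, sum_word_measure hξ, Finset.sum_ite_eq',
    Finset.mem_univ, if_true]
  ring

theorem sum_wordLaw_snoc (hξ : Measurable ξ) (n : ℕ) (w : Fin n → Fin k) :
    ∑ l, wordLaw μ ξ bad (n + 1) (Fin.snoc (α := fun _ => Fin k) w l) = wordLaw μ ξ bad n w := by
  have h1 : ∀ l, word ξ (n + 1) ⁻¹' {Fin.snoc (α := fun _ => Fin k) w l} =
      word ξ n ⁻¹' {w} ∩ (fun y => ξ (step^[n] y)) ⁻¹' {l} := by
    intro l
    ext y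
    simp only [Set.mem_preimage, Set.mem_singleton_iff, Set.mem_inter_iff, word_succ_eq_snoc]
    constructor
    · intro h
      have h2 := congrArg (Fin.init (α := fun _ => Fin k)) h
      have h3 := congrFun h (Fin.last n)
      simp only [Fin.init_snoc, Fin.snoc_last] at h2 h3
      exact ⟨h2, h3⟩
    · rintro ⟨h2, h3⟩
      rw [h2, h3]
  have h2 : ∀ l, (Fin.snoc (α := fun _ => Fin k) w l = fun _ => bad) ↔
      (w = fun _ => bad) ∧ l = bad := by
    intro l
    constructor
    · intro h
      have h2 := congrArg (Fin.init (α := fun _ => Fin k)) h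
      have h3 := congrFun h (Fin.last n)
      simp only [Fin.init_snoc, Fin.snoc_last] at h2 h3
      exact ⟨h2, h3⟩
    · rintro ⟨rfl, rfl⟩
      ext i
      refine Fin.lastCases ?_ (fun i => ?_) i <;> simp
  have hw := measurable_word hξ n (MeasurableSet.singleton w)
  have hl : ∀ l, MeasurableSet ((fun y => ξ (step^[n] y)) ⁻¹' {l}) := fun l =>
    (hξ.comp (continuous_step.iterate n).measurable) (MeasurableSet.singleton l)
  have h3 : ∑ l, μ.real (word ξ n ⁻¹' {w} ∩ (fun y => ξ (step^[n] y)) ⁻¹' {l}) =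
      μ.real (word ξ n ⁻¹' {w}) := by
    have := sum_measureReal_preimage_singleton (μ := μ.restrict (word ξ n ⁻¹' {w})) Finset.univ
      (f := fun y => ξ (step^[n] y)) fun l _ => hl l
    simp only [Finset.coe_univ, Set.preimage_univ, measureReal_restrict_apply_univ,
      measureReal_restrict_apply (hl _)] at this
    rw [← this]
    exact Finset.sum_congr rfl fun l _ => by rw [Set.inter_comm]
  simp only [wordLaw, h1, h2, Finset.sum_add_distrib, h3]
  congr 1
  by_cases hwb : w = fun _ => bad <;> simp [hwb]

theorem entropy_wordLaw_zero (hξ : Measurable ξ) :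
    ∑ w, Real.negMulLog (wordLaw μ ξ bad 0 w) = 0 := by
  have h := sum_wordLaw (μ := μ) (bad := bad) hξ 0
  rw [Fintype.sum_unique] at h ⊢
  rw [h, Real.negMulLog_one]

/-- Splitting off the escaped mass changes the entropy of the words of length `n` by a bounded
amount, which disappears after division by `n`. -/
theorem entropy_wordLaw_le (hξ : Measurable ξ) (h0 : μ Set.univ ≠ 0) (h1 : μ.real Set.univ ≤ 1)
    (n : ℕ) : ∑ w, Real.negMulLog (wordLaw μ ξ bad n w) ≤
      joinEntropy ((μ Set.univ)⁻¹ • μ) step ξ n + 2 := by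
  set m := μ.real Set.univ with hm
  have hm0 : 0 < m := (measureReal_nonneg).lt_of_ne' (by
    rw [measureReal_def, Ne, ENNReal.toReal_eq_zero_iff]; simp [h0])
  set ν : Measure X := (μ Set.univ)⁻¹ • μ with hν
  have hνS : ∀ S, ν.real S = m⁻¹ * μ.real S := by
    intro S
    rw [hν, measureReal_ennreal_smul_apply, ENNReal.toReal_inv, hm, measureReal_def μ Set.univ]
  have hνle : ∀ S, ν.real S ≤ 1 := by
    intro S
    rw [hνS, inv_mul_le_one₀ hm0]
    exact measureReal_mono (Set.subset_univ S)
  have hJ : joinEntropy ν step ξ n = ∑ w, Real.negMulLog (ν.real (word ξ n ⁻¹' {w})) := by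
    refine Finset.sum_congr rfl fun w _ => ?_
    congr 2
    ext y
    simp [word, funext_iff]
  have hJ0 : 0 ≤ joinEntropy ν step ξ n := by
    rw [hJ]
    exact Finset.sum_nonneg fun w _ => Real.negMulLog_nonneg measureReal_nonneg (hνle _)
  have hterm : ∀ w, Real.negMulLog (wordLaw μ ξ bad n w) ≤
      ν.real (word ξ n ⁻¹' {w}) * Real.negMulLog m +
        m * Real.negMulLog (ν.real (word ξ n ⁻¹' {w})) +
        if w = (fun _ => bad) then Real.negMulLog (1 - m) else 0 := by
    intro w
    rw [← Real.negMulLog_mul, hνS, mul_inv_cancel_left₀ hm0.ne']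
    refine (negMulLog_add_le measureReal_nonneg (by split_ifs <;> linarith)).trans (le_of_eq ?_)
    congr 1
    split_ifs <;> simp [hm]
  refine (Finset.sum_le_sum fun w _ => hterm w).trans ?_
  simp only [Finset.sum_add_distrib, ← Finset.sum_mul, ← Finset.mul_sum, Finset.sum_ite_eq',
    Finset.mem_univ, if_true]
  rw [← hJ]
  have h2 : ∑ w, ν.real (word ξ n ⁻¹' {w}) = 1 := by
    simp only [hνS, ← Finset.mul_sum]
    rw [sum_word_measure hξ, inv_mul_cancel₀ hm0.ne']
  rw [h2, one_mul]
  have h3 := negMulLog_le_one hm0.le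
  have h4 := negMulLog_le_one (x := 1 - m) (by linarith)
  have h5 : m * joinEntropy ν step ξ n ≤ joinEntropy ν step ξ n := mul_le_of_le_one_left hJ0 h1
  linarith

/-- If the normalization of `μ` has entropy at most `γ`, then at some length the conditional entropy
of the next letter is at most `γ + ε`. -/
theorem exists_entropy_increment_le (hξ : Measurable ξ) (h0 : μ Set.univ ≠ 0)
    (h1 : μ.real Set.univ ≤ 1) {γ : ℝ} (hγ : 0 < γ)
    (hent : entropy ((μ Set.univ)⁻¹ • μ) step ≤ ENNReal.ofReal γ) {ε : ℝ} (hε : 0 < ε) :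
    ∃ N, ∑ w, Real.negMulLog (wordLaw μ ξ bad (N + 1) w) -
      ∑ w, Real.negMulLog (wordLaw μ ξ bad N w) ≤ γ + ε := by
  set H : ℕ → ℝ := fun n => ∑ w, Real.negMulLog (wordLaw μ ξ bad n w) with hH
  by_contra! hcon
  -- Otherwise the increments add up to a linear growth of rate above `γ`.
  have hlow : ∀ n : ℕ, n * (γ + ε) ≤ H n := by
    intro n
    induction n with
    | zero => simp [hH, entropy_wordLaw_zero hξ]
    | succ n ih =>
      have h2 : γ + ε < H (n + 1) - H n := hcon n
      push_cast
      linarith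
  have hlim : limsup (fun n : ℕ => ENNReal.ofReal
      (joinEntropy ((μ Set.univ)⁻¹ • μ) step ξ n / n)) atTop < ENNReal.ofReal (γ + ε / 2) := by
    have h2 : partitionEntropy ((μ Set.univ)⁻¹ • μ) step ξ ≤ ENNReal.ofReal γ := by
      refine le_trans ?_ hent
      unfold entropy
      exact le_iSup_of_le k (le_iSup_of_le ξ (le_iSup_of_le hξ le_rfl))
    exact lt_of_le_of_lt h2 ((ENNReal.ofReal_lt_ofReal_iff (by linarith)).2 (by linarith))
  have hev := eventually_lt_of_limsup_lt hlim
  obtain ⟨n, hn, hn1⟩ := (hev.and (eventually_gt_atTop ⌈4 / ε⌉₊)).exists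
  have hn2 : 4 / ε < n := (Nat.le_ceil _).trans_lt (by exact_mod_cast hn1)
  have hn0 : (0 : ℝ) < n := lt_trans (by positivity) hn2
  rw [ENNReal.ofReal_lt_ofReal_iff (by linarith), div_lt_iff₀ hn0] at hn
  rw [div_lt_iff₀ hε] at hn2
  have h2 := entropy_wordLaw_le (bad := bad) hξ h0 h1 n
  have h3 := hlow n
  simp only [hH] at h3
  nlinarith

theorem sum_wordLaw_bad (hξ : Measurable ξ) (N : ℕ) :
    ∑ w, wordLaw μ ξ bad (N + 1) w * (if w 0 = bad then 6 else 0) =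
      6 * (μ.real (ξ ⁻¹' {bad}) + (1 - μ.real Set.univ)) := by
  have h1 : ∑ w, μ.real (word ξ (N + 1) ⁻¹' {w}) * (if w 0 = bad then (6 : ℝ) else 0) =
      6 * μ.real (ξ ⁻¹' {bad}) := by
    have h2 := sum_measureReal_preimage_singleton (μ := μ)
      (Finset.univ.filter fun w : Fin (N + 1) → Fin k => w 0 = bad)
      (f := word ξ (N + 1)) fun w _ => measurable_word hξ _ (MeasurableSet.singleton w)
    have h3 : word ξ (N + 1) ⁻¹' ((Finset.univ.filter fun w : Fin (N + 1) → Fin k => w 0 = bad :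
        Finset _) : Set (Fin (N + 1) → Fin k)) = ξ ⁻¹' {bad} := by
      ext y
      simp [word]
    rw [h3, Finset.sum_filter] at h2
    rw [← h2, Finset.mul_sum]
    refine Finset.sum_congr rfl fun w _ => ?_
    split_ifs <;> ring
  simp only [wordLaw, add_mul, Finset.sum_add_distrib, h1, ite_mul, zero_mul, Finset.sum_ite_eq',
    Finset.mem_univ, if_true]
  ring

end WordLaw

/-- A measure which lost mass less than `γ`, and whose normalization has entropy at most `γ`, admits
continuous coding costs of mean less than `8γ`; the value `κ` of the cost at infinity accounts for
the lost mass. -/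
theorem exists_codingCost {μ : Measure X} [IsFiniteMeasure μ] {γ : ℝ} (hγ : 0 < γ) (hγ1 : γ < 1)
    (hinv : AInvariant μ) (h0 : ENNReal.ofReal (1 - γ) < μ Set.univ) (h1 : μ Set.univ ≤ 1)
    (hent : entropy ((μ Set.univ)⁻¹ • μ) step ≤ ENNReal.ofReal γ) :
    ∃ (φ : C(X, ℝ)) (κ : ℝ), HasCompactSupport φ ∧ (∀ y, 0 ≤ φ y + κ) ∧
      IsCodingCost (fun y => φ y + κ) ∧ ∫ y, φ y ∂μ + κ < 8 * γ := by
  classical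
  have hm0 : 1 - γ < μ.real Set.univ := by
    rw [ENNReal.ofReal_lt_iff_lt_toReal (by linarith) (measure_ne_top _ _)] at h0
    exact h0
  have hm1 : μ.real Set.univ ≤ 1 := ENNReal.toReal_le_of_le_ofReal zero_le_one (by simpa using h1)
  have hne : μ Set.univ ≠ 0 := fun h => by rw [h] at h0; exact not_lt_zero h0
  obtain ⟨η, hη, hη1, k, ξ, bad, hξ, hbad, ⟨K, hK, hξK⟩, hloc, hthin⟩ :=
    exists_partition μ (ε := γ / 10) (by positivity)
  obtain ⟨N, hN⟩ := exists_entropy_increment_le (bad := bad) hξ hne hm1 hγ hent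
    (ε := γ / 10) (by positivity)
  have : Nonempty (Fin k) := ⟨bad⟩
  obtain ⟨q, hq0, hq1, hq⟩ := exists_code (wordLaw_nonneg (ξ := ξ) (bad := bad) hm1 (N + 1))
    (sum_wordLaw hξ _) (ε := γ / 10) (by positivity)
  simp only [sum_wordLaw_snoc hξ] at hq
  have hcost0 : ∀ w, 0 ≤ cost q bad w := by
    intro w
    have h2 : q w ≤ 1 := by
      have h3 := Finset.single_le_sum
        (f := fun l => q (Fin.snoc (α := fun _ => Fin k) (Fin.init w) l))
        (fun l _ => (hq0 _).le) (Finset.mem_univ (w (Fin.last N)))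
      simp only [Fin.snoc_init_self] at h3
      exact h3.trans (hq1 _)
    have := Real.log_nonpos (hq0 w).le h2
    rw [cost]
    split_ifs <;> linarith
  have hcomp : IsCompact (⋃ i : Fin (N + 1), step^[i] ⁻¹' K) := by
    refine isCompact_iUnion fun i => ?_
    have : step^[i] = Homeomorph.smul (a i 0) := funext fun y => iterate_step i y
    rw [this]
    exact (Homeomorph.isCompact_preimage _).2 hK
  have hσK : ∀ y ∉ ⋃ i : Fin (N + 1), step^[i] ⁻¹' K, word ξ (N + 1) y = fun _ => bad := by
    intro y hy
    ext i
    rw [Set.mem_iUnion, not_exists] at hy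
    exact congrArg Fin.val (hξK _ (hy i))
  have hlocw : ∀ᵐ y ∂μ, ∀ᶠ z in 𝓝 y, word ξ (N + 1) z = word ξ (N + 1) y := by
    have : ∀ᵐ y ∂μ, ∀ i : Fin (N + 1), ∀ᶠ z in 𝓝 (step^[i] y), ξ z = ξ (step^[i] y) := by
      refine ae_all_iff.2 fun i => ?_
      have hmap : μ.map (step^[i]) = μ := by
        have := hinv _ (a_mem_A i 0)
        rwa [← funext (iterate_step i)] at this
      rw [← hmap] at hloc
      exact ae_of_ae_map (continuous_step.iterate i).aemeasurable hloc
    filter_upwards [this] with y hy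
    filter_upwards [eventually_all.2 fun i : Fin (N + 1) =>
      (continuous_step.iterate i).continuousAt.eventually (hy i)] with z hz
    exact funext hz
  obtain ⟨φ, κ, hφ1, hφ2, hφ3⟩ := exists_continuous_majorant (μ := μ) (σ := word ξ (N + 1))
    (fun w => measurable_word hξ _ (MeasurableSet.singleton w)) hcomp hσK hlocw hcost0
    (ε := γ / 10) (by positivity)
  refine ⟨φ, κ, hφ1, fun y => (hcost0 _).trans (hφ2 y),
    (isCodingCost_cost hq0 hq1 hη hη1 hthin).mono hφ2, hφ3.trans_lt ?_⟩
  have hb := sum_wordLaw_bad (μ := μ) (bad := bad) hξ N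
  have hsum : ∑ w, cost q bad w * (μ.real (word ξ (N + 1) ⁻¹' {w}) +
      if w = (fun _ => bad) then 1 - μ.real Set.univ else 0) =
      ∑ w, wordLaw μ ξ bad (N + 1) w * -Real.log (q w) +
        ∑ w, wordLaw μ ξ bad (N + 1) w * (if w 0 = bad then 6 else 0) := by
    rw [← Finset.sum_add_distrib]
    refine Finset.sum_congr rfl fun w _ => ?_
    rw [← mul_add, mul_comm]
    rfl
  rw [hsum, hb]
  linarith

/-! ### From averages over squares to averages along lines -/

/-- Uniform continuity of `φ` along the action of `A`. -/
theorem exists_uniform_delta {φ : C(X, ℝ)} (hφ : HasCompactSupport φ) {ε : ℝ} (hε : 0 < ε) :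
    ∃ δ > 0, ∀ s t : ℝ, |s| ≤ δ → |t| ≤ δ → ∀ y : X, φ (a s t • y) ≤ φ y + ε := by
  have hK : IsCompact (tsupport φ) := hφ
  have h := hK.eventually_forall_of_forall_eventually (x₀ := (0 : ℝ × ℝ))
    (P := fun p y => |φ (a p.1 p.2 • y) - φ y| < ε) (by
      intro y _
      have hc : Continuous fun q : (ℝ × ℝ) × X => |φ (a q.1.1 q.1.2 • q.2) - φ q.2| := by
        have h1 : Continuous fun q : (ℝ × ℝ) × X => a q.1.1 q.1.2 • q.2 :=
          (continuous_a.comp continuous_fst).smul continuous_snd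
        exact ((φ.continuous.comp h1).sub (φ.continuous.comp continuous_snd)).abs
      exact hc.continuousAt.eventually_lt continuousAt_const (by simpa [a_zero] using hε))
  obtain ⟨ρ, hρ, h⟩ := Metric.eventually_nhds_iff.1 h
  have key : ∀ s t : ℝ, |s| ≤ ρ / 2 → |t| ≤ ρ / 2 → ∀ y ∈ tsupport φ,
      |φ (a s t • y) - φ y| < ε := by
    intro s t hs ht y hy
    refine h (y := (s, t)) ?_ y hy
    rw [dist_zero_right, Prod.norm_def, Real.norm_eq_abs, Real.norm_eq_abs]
    exact (max_le hs ht).trans_lt (half_lt_self hρ)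
  refine ⟨ρ / 2, half_pos hρ, fun s t hs ht y => ?_⟩
  by_cases hy : y ∈ tsupport φ
  · have := (abs_lt.1 (key s t hs ht y hy)).2
    linarith
  · rw [image_eq_zero_of_notMem_tsupport hy]
    by_cases hy' : a s t • y ∈ tsupport φ
    · have h1 := key (-s) (-t) (by rwa [abs_neg]) (by rwa [abs_neg]) _ hy'
      rw [← mul_smul, a_mul_a, neg_add_cancel, neg_add_cancel, a_zero, one_smul,
        image_eq_zero_of_notMem_tsupport hy] at h1
      have := (abs_lt.1 h1).1
      linarith
    · rw [image_eq_zero_of_notMem_tsupport hy']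
      linarith

/-- If a nonnegative function has small mean over `[0,T]²`, then it has small mean along a
horizontal line of low height. -/
theorem exists_line_sum_le {h : ℝ × ℝ → ℝ} (hc : Continuous h) (h0 : ∀ p, 0 ≤ h p) {T b C : ℝ}
    {n : ℕ} (hn : n ≤ T) (hb : 0 < b) (hbT : b ≤ T)
    (hI : ∫ p in Set.Icc (0 : ℝ) T ×ˢ Set.Icc (0 : ℝ) T, h p ≤ C) :
    ∃ s ∈ Set.Icc (0 : ℝ) 1, ∃ t ∈ Set.Icc (0 : ℝ) b,
      ∑ j ∈ Finset.range n, h (s + j, t) ≤ C / b := by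
  -- The translates `R' j` of `R` are disjoint parts of the square; the sum is averaged over `R`.
  set R : Set (ℝ × ℝ) := Set.Ico (0 : ℝ) 1 ×ˢ Set.Icc (0 : ℝ) b with hR
  set R' : ℕ → Set (ℝ × ℝ) := fun j => Set.Ico (j : ℝ) (j + 1) ×ˢ Set.Icc (0 : ℝ) b with hR'
  have hmeas : ∀ j, MeasurableSet (R' j) := fun j => measurableSet_Ico.prod measurableSet_Icc
  have hint : ∀ (S : Set (ℝ × ℝ)) (r : ℝ), S ⊆ Set.Icc (0 : ℝ) r ×ˢ Set.Icc (0 : ℝ) r →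
      ∀ h : ℝ × ℝ → ℝ, Continuous h → IntegrableOn h S := fun S r hS h hc =>
    (hc.continuousOn.integrableOn_compact (isCompact_Icc.prod isCompact_Icc)).mono_set hS
  have hR'sub : ∀ j ∈ Finset.range n, R' j ⊆ Set.Icc (0 : ℝ) T ×ˢ Set.Icc (0 : ℝ) T := by
    rintro j hj ⟨s, t⟩ ⟨⟨h1, h2⟩, h3, h4⟩
    have h5 : (j : ℝ) + 1 ≤ n := by exact_mod_cast Finset.mem_range.1 hj
    have h6 : (0 : ℝ) ≤ j := Nat.cast_nonneg j
    simp only at h1 h2 h3 h4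
    exact ⟨⟨by simp only; linarith, by simp only; linarith⟩, h3, h4.trans hbT⟩
  have hshift : ∀ j : ℕ, ∫ p in R, h (p.1 + j, p.2) = ∫ p in R' j, h p := by
    intro j
    have e := (measurePreserving_add_right (volume : Measure (ℝ × ℝ)) ((j : ℝ), (0 : ℝ)))
      |>.setIntegral_preimage_emb (measurableEmbedding_addRight _) h (R' j)
    rw [← e]
    have : (fun p : ℝ × ℝ => p + ((j : ℝ), (0 : ℝ))) ⁻¹' R' j = R := by
      ext ⟨s, t⟩
      simp only [hR, hR', Set.mem_preimage, Set.mem_prod, Prod.mk_add_mk, Set.mem_Ico, Set.mem_Icc,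
        add_zero]
      constructor
      · rintro ⟨⟨h1, h2⟩, h3⟩
        exact ⟨⟨by linarith, by linarith⟩, h3⟩
      · rintro ⟨⟨h1, h2⟩, h3⟩
        exact ⟨⟨by linarith, by linarith⟩, h3⟩
    rw [this]
    refine integral_congr_ae (ae_of_all _ fun p => ?_)
    simp only
    congr 1
    ext <;> simp
  have hdisj : (↑(Finset.range n) : Set ℕ).Pairwise (Function.onFun Disjoint R') := by
    intro i _ j _ hij
    refine Set.disjoint_left.2 ?_
    rintro ⟨s, t⟩ ⟨⟨h1, h2⟩, -⟩ ⟨⟨h3, h4⟩, -⟩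
    simp only at h1 h2 h3 h4
    have h5 : (i : ℝ) < j + 1 := by linarith
    have h6 : (j : ℝ) < i + 1 := by linarith
    norm_cast at h5 h6
    omega
  have hcj : ∀ j : ℕ, Continuous fun p : ℝ × ℝ => h (p.1 + j, p.2) := fun j => by fun_prop
  have hRsub : R ⊆ Set.Icc (0 : ℝ) (max 1 b) ×ˢ Set.Icc (0 : ℝ) (max 1 b) := by
    rintro ⟨s, t⟩ ⟨⟨h1, h2⟩, h3, h4⟩
    exact ⟨⟨h1, h2.le.trans (le_max_left _ _)⟩, h3, h4.trans (le_max_right _ _)⟩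
  have hsum : ∫ p in R, ∑ j ∈ Finset.range n, h (p.1 + j, p.2) ≤ C := by
    rw [integral_finsetSum _ fun j _ => hint R _ hRsub _ (hcj j)]
    simp only [hshift]
    rw [← integral_biUnion_finset _ (fun j _ => hmeas j) hdisj
      fun j hj => hint _ T (hR'sub j hj) h hc]
    refine le_trans (setIntegral_mono_set (hint _ T subset_rfl h hc) (ae_of_all _ h0) ?_) hI
    exact (Set.iUnion₂_subset hR'sub).eventuallyLE
  have hvol : volume R = ENNReal.ofReal b := by
    rw [hR, Measure.volume_eq_prod, Measure.prod_prod, Real.volume_Ico, Real.volume_Icc]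
    simp
  obtain ⟨⟨s, t⟩, ⟨hs, ht⟩, hle⟩ := exists_le_setAverage (μ := volume) (s := R)
    (f := fun p => ∑ j ∈ Finset.range n, h (p.1 + j, p.2))
    (by rw [hvol]; exact (ENNReal.ofReal_pos.2 hb).ne') (by rw [hvol]; exact ENNReal.ofReal_ne_top)
    (integrable_finsetSum _ fun j _ => hint R _ hRsub _ (hcj j))
  refine ⟨s, ⟨hs.1, hs.2.le⟩, t, ht, hle.trans ?_⟩
  rw [setAverage_eq, measureReal_def, hvol, ENNReal.toReal_ofReal hb.le, smul_eq_mul,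
    inv_mul_eq_div]
  gcongr

/-- The points `v` of the unit square of `U` such that the cost `g` has mean less than `c` over the
square of side `T` in the orbit of `v x₀`, for some `T ∈ [n, n + 1)`. -/
def cheapAt (g : X → ℝ) (c : ℝ) (x₀ : X) (n : ℕ) : Set (ℝ × ℝ) :=
  {v | |v.1| ≤ 1 ∧ |v.2| ≤ 1 ∧ ∃ T : ℝ, 0 < T ∧ n ≤ T ∧ T ≤ n + 1 ∧
    ∫ p in Set.Icc (0 : ℝ) T ×ˢ Set.Icc (0 : ℝ) T, g (a p.1 p.2 • unip v • x₀) ≤ c * T ^ 2}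

/-- Covering at a fixed starting point `(s, t)` of the horizontal line: `e^{3(s+t)}` cells are
needed to reach the line, and the coding cost counts the rest. -/
theorem exists_cov_line {g : X → ℝ} (hg : IsCodingCost g) :
    ∃ B > 0, ∀ (x₀ : X) (s t E : ℝ) (n : ℕ), 0 ≤ s → 0 ≤ t →
      Cov {v | |v.1| ≤ 1 ∧ |v.2| ≤ 1 ∧
        ∑ j ∈ Finset.range n, g (step^[j] (a s t • unip v • x₀)) ≤ E}
        (8 * Real.exp (-n)) (B * Real.exp (3 * s + 3 * t) * Real.exp E) := by
  obtain ⟨η, hη, hη1, C, hC, h⟩ := hg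
  refine ⟨25 / η ^ 2 * C, by positivity, fun x₀ s t E n hs ht => ?_⟩
  set S := {v : ℝ × ℝ | |v.1| ≤ 1 ∧ |v.2| ≤ 1 ∧
        ∑ j ∈ Finset.range n, g (step^[j] (a s t • unip v • x₀)) ≤ E}
  have hceil : ∀ L : ℝ, 1 ≤ L → L ≤ ⌈L / η⌉₊ * η ∧ 2 * (⌈L / η⌉₊ : ℝ) + 1 ≤ 5 * L / η := by
    intro L hL
    have h1 : 1 ≤ L / η := by rw [le_div_iff₀ hη]; linarith
    have h2 := Nat.ceil_lt_add_one (show 0 ≤ L / η by positivity)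
    constructor
    · rw [← div_le_iff₀ hη]; exact Nat.le_ceil _
    · rw [mul_div_assoc]; linarith
  have hL1 : 1 ≤ Real.exp (2 * s + t) := Real.one_le_exp (by linarith)
  have hL2 : 1 ≤ Real.exp (s + 2 * t) := Real.one_le_exp (by linarith)
  obtain ⟨h1, h1'⟩ := hceil _ hL1
  obtain ⟨h2, h2'⟩ := hceil _ hL2
  have hcov : Cov (stretch s t '' S) (8 * Real.exp (-n)) _ :=
    Cov.cells hη 0 ⌈Real.exp (2 * s + t) / η⌉₊ ⌈Real.exp (s + 2 * t) / η⌉₊ (by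
      rintro _ ⟨v, ⟨hv1, hv2, -⟩, rfl⟩
      simp only [stretch, Prod.fst_zero, Prod.snd_zero, sub_zero, abs_mul, Real.abs_exp]
      exact ⟨(mul_le_of_le_one_right (Real.exp_pos _).le hv1).trans h1,
        (mul_le_of_le_one_right (Real.exp_pos _).le hv2).trans h2⟩)
      fun B hB hBd => h n (a s t • x₀) E B hBd fun v' hv' => by
        obtain ⟨v, ⟨-, -, hv⟩, rfl⟩ := hB hv'
        rwa [← mul_smul, ← a_mul_unip, mul_smul]
  have hcov' := Cov.of_image one_pos (le_dist_stretch (s := s) (t := t) hL1 hL2) hcov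
  rw [div_one] at hcov'
  refine hcov'.mono ?_
  calc (2 * (⌈Real.exp (2 * s + t) / η⌉₊ : ℝ) + 1) * (2 * (⌈Real.exp (s + 2 * t) / η⌉₊ : ℝ) + 1) *
        (C * Real.exp E)
      ≤ (5 * Real.exp (2 * s + t) / η) * (5 * Real.exp (s + 2 * t) / η) * (C * Real.exp E) := by
        gcongr
    _ = 25 / η ^ 2 * C * (Real.exp (2 * s + t) * Real.exp (s + 2 * t)) * Real.exp E := by
        field_simp; ring
    _ = _ := by rw [← Real.exp_add]; ring_nf

/-- For the best height `t ≤ θ T` of the line, reaching the line contributes `3θ` and following it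
contributes `c / θ` to the exponent. -/
theorem exists_cov_cheapAt {φ : C(X, ℝ)} {κ : ℝ} (hφ : HasCompactSupport φ)
    (h0 : ∀ y, 0 ≤ φ y + κ) (hg : IsCodingCost fun y => φ y + κ) {c θ ε : ℝ} (hc : 0 < c)
    (hθ : 0 < θ) (hθ1 : θ ≤ 1) (hε : 0 < ε) (x₀ : X) :
    ∃ B > 0, ∀ n : ℕ, Cov (cheapAt (fun y => φ y + κ) c x₀ n) (8 * Real.exp (-n))
      (B * (n + 1) * Real.exp ((3 * θ + c / θ + ε) * n)) := by
  obtain ⟨δ, hδ, hunif⟩ := exists_uniform_delta hφ hε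
  obtain ⟨B, hB, hcov⟩ := exists_cov_line hg
  set I := ⌊1 / δ⌋₊ + 1 with hI
  have hIδ : 1 / δ < I := by rw [hI]; push_cast; exact Nat.lt_floor_add_one _
  refine ⟨I * I * B * Real.exp (3 + 3 * θ + c / θ), by positivity, fun n => ?_⟩
  set E : ℝ := c * (n + 1) / θ + n * ε with hE
  -- The starting points of the lines are rounded to a grid of mesh `δ`.
  have key : ∀ i ∈ Finset.range I ×ˢ Finset.range (I * (n + 1)),
      Cov {v : ℝ × ℝ | i.1 * δ ≤ 1 ∧ i.2 * δ ≤ θ * (n + 1) ∧ |v.1| ≤ 1 ∧ |v.2| ≤ 1 ∧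
        ∑ j ∈ Finset.range n, (φ (step^[j] (a (i.1 * δ) (i.2 * δ) • unip v • x₀)) + κ) ≤ E}
        (8 * Real.exp (-n)) (B * Real.exp (3 + 3 * (θ * (n + 1))) * Real.exp E) := by
    rintro ⟨i, k⟩ -
    by_cases hik : i * δ ≤ 1 ∧ k * δ ≤ θ * (n + 1)
    · refine ((hcov x₀ (i * δ) (k * δ) E n (by positivity) (by positivity)).mono_set
        fun v hv => ⟨hv.2.2.1, hv.2.2.2.1, hv.2.2.2.2⟩).mono ?_
      have := hik.1
      have := hik.2
      gcongr
      linarith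
    · refine (Cov.empty (by positivity)).mono_set ?_
      rintro v ⟨h1, h2, -⟩
      exact hik ⟨h1, h2⟩
  refine ((Cov.biUnion _ _ _ key).mono_set ?_).mono (le_of_eq ?_)
  · rintro v ⟨hv1, hv2, T, hT, hnT, hTn, hint⟩
    have hcont : Continuous fun p : ℝ × ℝ => φ (a p.1 p.2 • unip v • x₀) + κ :=
      (φ.continuous.comp (continuous_a.smul continuous_const)).add continuous_const
    obtain ⟨s, hs, t, ht, hsum⟩ := exists_line_sum_le hcont (fun p => h0 _) hnT
      (mul_pos hθ hT) (mul_le_of_le_one_left hT.le hθ1) hint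
    have hround : ∀ x : ℝ, 0 ≤ x → |⌊x / δ⌋₊ * δ - x| ≤ δ ∧ ⌊x / δ⌋₊ * δ ≤ x := by
      intro x hx
      have h1 : ⌊x / δ⌋₊ * δ ≤ x := by
        rw [← le_div_iff₀ hδ]; exact Nat.floor_le (by positivity)
      have h2 : x < (⌊x / δ⌋₊ + 1) * δ := by
        rw [← div_lt_iff₀ hδ]; exact Nat.lt_floor_add_one _
      exact ⟨abs_le.2 ⟨by linarith, by linarith⟩, h1⟩
    obtain ⟨hs1, hs2⟩ := hround s hs.1
    obtain ⟨ht1, ht2⟩ := hround t ht.1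
    have htn : t ≤ θ * (n + 1) := ht.2.trans (by gcongr)
    simp only [Set.mem_iUnion]
    refine ⟨(⌊s / δ⌋₊, ⌊t / δ⌋₊), Finset.mem_product.2 ⟨Finset.mem_range.2 ?_,
      Finset.mem_range.2 ?_⟩, hs2.trans hs.2, ht2.trans htn, hv1, hv2, ?_⟩
    · exact Nat.lt_succ_of_le (Nat.floor_mono (by gcongr; exact hs.2))
    · have h1 : t / δ ≤ 1 / δ * (n + 1) := by
        rw [div_mul_eq_mul_div, one_mul]
        gcongr
        exact htn.trans (mul_le_of_le_one_left (by positivity) hθ1)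
      have h2 : t / δ < ((I * (n + 1) : ℕ) : ℝ) := by
        push_cast
        exact h1.trans_lt (mul_lt_mul_of_pos_right hIδ (by positivity))
      exact (Nat.floor_lt (div_nonneg ht.1 hδ.le)).2 h2
    · have h1 : ∀ j ∈ Finset.range n,
          φ (step^[j] (a (⌊s / δ⌋₊ * δ) (⌊t / δ⌋₊ * δ) • unip v • x₀)) + κ ≤
            (φ (a (s + j) t • unip v • x₀) + κ) + ε := by
        intro j _
        have h2 := hunif _ _ hs1 ht1 (a (s + j) t • unip v • x₀)
        rw [← mul_smul, a_mul_a] at h2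
        rw [iterate_step, ← mul_smul, a_mul_a, zero_add]
        rw [sub_add_cancel, show (⌊s / δ⌋₊ * δ - s + (s + j)) = j + ⌊s / δ⌋₊ * δ by ring] at h2
        linarith
      refine (Finset.sum_le_sum h1).trans ?_
      rw [Finset.sum_add_distrib, Finset.sum_const, Finset.card_range, nsmul_eq_mul, hE]
      have h3 : c * T ^ 2 / (θ * T) ≤ c * (n + 1) / θ := by
        rw [show c * T ^ 2 / (θ * T) = c * T / θ by field_simp]
        gcongr
      linarith
  · rw [Finset.sum_const, Finset.card_product, Finset.card_range, Finset.card_range, nsmul_eq_mul]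
    have : Real.exp (3 + 3 * (θ * (n + 1))) * Real.exp E =
        Real.exp (3 + 3 * θ + c / θ) * Real.exp ((3 * θ + c / θ + ε) * n) := by
      rw [← Real.exp_add, ← Real.exp_add, hE]
      congr 1
      ring
    push_cast
    linear_combination (I * (I * (n + 1)) * B : ℝ) * this

/-! ### Hausdorff dimension -/

/-- The points lying in infinitely many of the sets `S n`, where `S n` is covered by
`O((n + 1) e^{λn})` sets of diameter `O(e^{-n})`, form a set of dimension at most `d > λ`. -/
theorem dimH_frequently_le {S : ℕ → Set (ℝ × ℝ)} {B l d : ℝ} (hB : 0 ≤ B) (hd0 : 0 ≤ d)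
    (hd : l < d)
    (hcov : ∀ n : ℕ, Cov (S n) (8 * Real.exp (-n)) (B * (n + 1) * Real.exp (l * n))) :
    dimH {v | ∃ᶠ n in atTop, v ∈ S n} ≤ ENNReal.ofReal d := by
  choose t ht1 ht2 ht3 using hcov
  set w : ℕ → ℝ := fun n => B * (n + 1) * Real.exp (l * n) * (8 * Real.exp (-n)) ^ d with hw
  have hw0 : ∀ n, 0 ≤ w n := fun n => by positivity
  have hws : Summable w := by
    have h1 := Real.summable_pow_mul_exp_neg_nat_mul 1 (sub_pos.2 hd)
    have h2 := Real.summable_pow_mul_exp_neg_nat_mul 0 (sub_pos.2 hd)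
    refine ((h1.add h2).mul_left (B * 8 ^ d)).congr fun n => ?_
    simp only [hw]
    rw [Real.mul_rpow (by norm_num) (Real.exp_pos _).le, ← Real.exp_mul]
    have : Real.exp (l * n) * Real.exp (-n * d) = Real.exp (-(d - l) * n) := by
      rw [← Real.exp_add]; ring_nf
    rw [pow_one, pow_zero]
    linear_combination -(B * (n + 1) * 8 ^ d) * this
  have hdiam : ∀ n, ∀ A ∈ t n, Metric.ediam A ≤ ENNReal.ofReal (8 * Real.exp (-n)) := by
    intro n A hA
    refine Metric.ediam_le fun v hv v' hv' => ?_
    rw [edist_dist]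
    exact ENNReal.ofReal_le_ofReal (ht2 n A hA v hv v' hv')
  have hH : μH[d] {v | ∃ᶠ n in atTop, v ∈ S n} ≤ ∑' n, ENNReal.ofReal (w n) := by
    refine (Measure.hausdorffMeasure_le_liminf_tsum (l := atTop) (β := ℕ)
      (ι := fun m => Σ n : ℕ, {A // A ∈ t (m + n)}) d _
      (fun m => ENNReal.ofReal (8 * Real.exp (-m))) ?_ (fun m i => i.2.1) ?_ ?_).trans ?_
    · have h1 : Tendsto (fun m : ℕ => 8 * Real.exp (-m)) atTop (𝓝 (8 * 0)) :=
        (Real.tendsto_exp_neg_atTop_nhds_zero.comp tendsto_natCast_atTop_atTop).const_mul 8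
      have h2 := (ENNReal.continuous_ofReal.tendsto _).comp h1
      rwa [mul_zero, ENNReal.ofReal_zero] at h2
    · refine Eventually.of_forall fun m => ?_
      rintro ⟨n, A, hA⟩
      refine (hdiam _ A hA).trans (ENNReal.ofReal_le_ofReal ?_)
      push_cast
      gcongr
      have : (0 : ℝ) ≤ n := Nat.cast_nonneg n
      linarith
    · refine Eventually.of_forall fun m v hv => ?_
      obtain ⟨n, hn, hvn⟩ := (frequently_atTop.1 hv) m
      obtain ⟨A, hA, hvA⟩ := Set.mem_iUnion₂.1 (ht3 n hvn)
      obtain ⟨n, rfl⟩ := Nat.exists_eq_add_of_le hn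
      exact Set.mem_iUnion.2 ⟨⟨n, A, hA⟩, hvA⟩
    · refine (liminf_le_liminf (v := fun _ => ∑' n, ENNReal.ofReal (w n))
        (Eventually.of_forall fun m => ?_)).trans_eq (liminf_const _)
      rw [ENNReal.tsum_sigma']
      calc ∑' n, ∑' A : {A // A ∈ t (m + n)}, Metric.ediam A.1 ^ d
          ≤ ∑' n, ENNReal.ofReal (w (m + n)) := by
            refine ENNReal.tsum_le_tsum fun n => ?_
            rw [tsum_fintype]
            refine (Finset.sum_le_sum fun A _ =>
              ENNReal.rpow_le_rpow (hdiam _ A.1 A.2) hd0).trans ?_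
            rw [Finset.sum_const, nsmul_eq_mul, Finset.card_univ, Fintype.card_coe,
              ENNReal.ofReal_rpow_of_nonneg (by positivity) hd0, ← ENNReal.ofReal_natCast,
              ← ENNReal.ofReal_mul (Nat.cast_nonneg _)]
            exact ENNReal.ofReal_le_ofReal
              (mul_le_mul_of_nonneg_right (ht1 (m + n)) (by positivity))
        _ ≤ ∑' n, ENNReal.ofReal (w n) :=
            ENNReal.tsum_comp_le_tsum_of_injective (add_right_injective m) _
  have hfin : ∑' n, ENNReal.ofReal (w n) ≠ ⊤ := by
    rw [← ENNReal.ofReal_tsum_of_nonneg hw0 hws]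
    exact ENNReal.ofReal_ne_top
  refine dimH_le_of_hausdorffMeasure_ne_top (d := d.toNNReal) ?_
  rw [Real.coe_toNNReal d hd0]
  exact ne_top_of_le_ne_top hfin hH

/-! ### Countably many costs suffice -/

/-- Continuous coding costs `φ + κ` with `φ` supported in `K`. -/
def costsOn (K : Set X) : Set (C(X, ℝ) × ℝ) :=
  {p | tsupport p.1 ⊆ K ∧ (∀ y, 0 ≤ p.1 y + p.2) ∧ IsCodingCost fun y => p.1 y + p.2}

/-- The coding costs supported in `K` contain a countable set that is dense for uniform
convergence: the compact-open topology of `C(X, ℝ)` is second countable, and on functions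
supported in `K` it is the uniform one. -/
theorem exists_countable_costs {K : Set X} (hK : IsCompact K) :
    ∃ D ⊆ costsOn K, D.Countable ∧ ∀ p ∈ costsOn K, ∀ ε > 0,
      ∃ p' ∈ D, (∀ y, |p'.1 y - p.1 y| < ε) ∧ |p'.2 - p.2| < ε := by
  obtain ⟨D, hD, hdense⟩ := TopologicalSpace.exists_countable_dense (costsOn K)
  refine ⟨Subtype.val '' D, by rintro _ ⟨p, -, rfl⟩; exact p.2, hD.image _, ?_⟩
  intro p hp ε hε
  have hopen : IsOpen {q : costsOn K | Set.MapsTo (q.1.1 - p.1) K (Metric.ball 0 ε) ∧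
      q.1.2 ∈ Metric.ball p.2 ε} := by
    refine IsOpen.inter ?_ ?_
    · have h1 : Continuous fun q : costsOn K => q.1.1 - p.1 :=
        (continuous_fst.comp continuous_subtype_val).sub continuous_const
      exact (ContinuousMap.isOpen_setOfPred_mapsTo hK Metric.isOpen_ball).preimage h1
    · exact Metric.isOpen_ball.preimage (continuous_snd.comp continuous_subtype_val)
  obtain ⟨q, ⟨h1, h2⟩, hqD⟩ := hdense.inter_open_nonempty _ hopen
    ⟨⟨p, hp⟩, fun y _ => by simpa using hε, by simpa using hε⟩
  refine ⟨q, Set.mem_image_of_mem _ hqD, fun y => ?_, by simpa [Real.dist_eq] using h2⟩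
  by_cases hy : y ∈ K
  · simpa using h1 hy
  · rw [image_eq_zero_of_notMem_tsupport fun h => hy (q.2.1 h),
      image_eq_zero_of_notMem_tsupport fun h => hy (hp.1 h)]
    simpa using hε

theorem integral_empirical (φ : C(X, ℝ)) {T : ℝ} (x : X) :
    ∫ y, φ y ∂(empirical T x) =
      (T ^ 2)⁻¹ * ∫ p in Set.Icc (0 : ℝ) T ×ˢ Set.Icc (0 : ℝ) T, φ (a p.1 p.2 • x) := by
  rw [empirical, integral_smul_measure, integral_map, ENNReal.toReal_inv,
    ENNReal.toReal_ofReal (sq_nonneg T), smul_eq_mul]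
  · exact (continuous_a.smul continuous_const).aemeasurable
  · exact φ.continuous.aestronglyMeasurable

/-- The points of `Z` come infinitely often into the cheap sets of one of countably many costs. -/
theorem exists_frequently_cheapAt {x₀ : X} {γ : ℝ} (hγ : 0 < γ) (hγ1 : γ < 1)
    {Kn : CompactExhaustion X} {D : ℕ → Set (C(X, ℝ) × ℝ)} (hDK : ∀ m, D m ⊆ costsOn (Kn m))
    (hD : ∀ m, ∀ p ∈ costsOn (Kn m), ∀ ε > 0,
      ∃ p' ∈ D m, (∀ y, |p'.1 y - p.1 y| < ε) ∧ |p'.2 - p.2| < ε)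
    {u : U} (hu : u ∈ Z x₀ γ) :
    ∃ m, ∃ p ∈ D m,
      ∃ᶠ n in atTop, coordU u ∈ cheapAt (fun y => p.1 y + p.2) (8 * γ) x₀ n := by
  obtain ⟨hball, μ, hfin, ⟨T, hT0, hT, hconv⟩, hinv, hm0, hm1, hent⟩ := hu
  obtain ⟨φ₀, κ₀, hφ₀, hnn, hcode, hlt⟩ := exists_codingCost hγ hγ1 hinv hm0 hm1 hent
  obtain ⟨m, hm⟩ := Kn.exists_superset_of_isCompact hφ₀
  have hm1' : μ.real Set.univ ≤ 1 :=
    ENNReal.toReal_le_of_le_ofReal zero_le_one (by simpa using hm1)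
  -- Changing both `φ₀` and `κ₀` by less than `ε` leaves the mean below `8γ`, as `μ(X) ≤ 1`.
  set ε := (8 * γ - (∫ y, φ₀ y ∂μ + κ₀)) / 3 with hε
  have hε0 : 0 < ε := by rw [hε]; linarith
  obtain ⟨p, hpD, hp1, hp2⟩ := hD m (φ₀, κ₀) ⟨hm, hnn, hcode⟩ ε hε0
  have hps : HasCompactSupport p.1 :=
    HasCompactSupport.of_support_subset_isCompact (Kn.isCompact m)
      ((subset_tsupport _).trans (hDK m hpD).1)
  refine ⟨m, p, hpD, ?_⟩
  have hlt' : ∫ y, p.1 y ∂μ + p.2 < 8 * γ := by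
    have h1 : ∫ y, p.1 y ∂μ ≤ ∫ y, (φ₀ y + ε) ∂μ := by
      refine integral_mono (p.1.continuous.integrable_of_hasCompactSupport hps)
        ((φ₀.continuous.integrable_of_hasCompactSupport hφ₀).add (integrable_const _)) fun y => ?_
      have := (abs_lt.1 (hp1 y)).2
      simp only at this ⊢
      linarith
    rw [integral_add (φ₀.continuous.integrable_of_hasCompactSupport hφ₀) (integrable_const _),
      integral_const, smul_eq_mul] at h1
    have h2 := (abs_lt.1 hp2).2
    have h3 : μ.real Set.univ * ε ≤ ε := mul_le_of_le_one_left hε0.le hm1'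
    simp only at h2
    linarith
  have hlim : Tendsto (fun k => ∫ y, p.1 y ∂(empirical (T k) ((u : G) • x₀))) atTop
      (𝓝 (∫ y, p.1 y ∂μ)) := hconv ⟨p.1, hps.is_zero_at_infty⟩
  have hev := hlim.eventually (gt_mem_nhds (show ∫ y, p.1 y ∂μ < 8 * γ - p.2 by linarith))
  have hfl : Tendsto (fun k => ⌊T k⌋₊) atTop atTop := tendsto_nat_floor_atTop.comp hT
  refine hfl.frequently (Eventually.frequently ?_)
  filter_upwards [hev] with k hk
  have hclosed : u ∈ Metric.closedBall (1 : U) 1 := Metric.closure_ball_subset_closedBall hball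
  rw [Metric.mem_closedBall, dist_U] at hclosed
  have huG : (u : G) = unip (coordU u) := congrArg Subtype.val (mk_coordU u).symm
  refine ⟨?_, ?_, T k, hT0 k, Nat.floor_le (hT0 k).le, (Nat.lt_floor_add_one _).le, ?_⟩
  · simpa [coordU] using (le_max_left _ _).trans hclosed
  · simpa [coordU] using (le_max_right _ _).trans hclosed
  · rw [← huG]
    rw [integral_empirical] at hk
    have hTk := hT0 k
    have hint : IntegrableOn (fun q : ℝ × ℝ => p.1 (a q.1 q.2 • (u : G) • x₀))
        (Set.Icc (0 : ℝ) (T k) ×ˢ Set.Icc (0 : ℝ) (T k)) :=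
      (p.1.continuous.comp (continuous_a.smul continuous_const)).continuousOn.integrableOn_compact
        (isCompact_Icc.prod isCompact_Icc)
    have hvol : volume.real (Set.Icc (0 : ℝ) (T k) ×ˢ Set.Icc (0 : ℝ) (T k)) = T k ^ 2 := by
      rw [measureReal_def, Measure.volume_eq_prod, Measure.prod_prod, Real.volume_Icc, sub_zero,
        ← ENNReal.ofReal_mul hTk.le, ENNReal.toReal_ofReal (by positivity), sq]
    rw [integral_add hint (integrableOn_const (by
      rw [Measure.volume_eq_prod, Measure.prod_prod, Real.volume_Icc]; finiteness)),
      setIntegral_const, hvol, smul_eq_mul]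
    rw [inv_mul_lt_iff₀ (by positivity)] at hk
    linarith

theorem isometry_coordU : Isometry coordU := Isometry.of_dist_eq fun _ _ => rfl

end DiagFlow

theorem mainTheorem3 (x₀ : DiagFlow.X) (γ : ℝ) (hγ₀ : 0 < γ) (hγ₁ : γ < 1) :
    dimH (DiagFlow.Z x₀ γ) ≤ ENNReal.ofReal (15 * Real.sqrt γ) := by
  open DiagFlow in
  let Kn : CompactExhaustion X := CompactExhaustion.choice X
  choose D hDK hDc hD using fun m => exists_countable_costs (Kn.isCompact m)
  have hs0 : 0 < √γ := Real.sqrt_pos.2 hγ₀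
  have hs1 : √γ ≤ 1 := Real.sqrt_le_one.2 hγ₁.le
  have hsub : coordU '' Z x₀ γ ⊆ ⋃ m, ⋃ p ∈ D m,
      {v | ∃ᶠ n in Filter.atTop, v ∈ cheapAt (fun y => p.1 y + p.2) (8 * γ) x₀ n} := by
    rintro _ ⟨u, hu, rfl⟩
    obtain ⟨m, p, hp, h⟩ := exists_frequently_cheapAt hγ₀ hγ₁ hDK hD hu
    exact Set.mem_iUnion.2 ⟨m, Set.mem_biUnion hp h⟩
  rw [← isometry_coordU.dimH_image]
  refine (dimH_mono hsub).trans ?_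
  rw [dimH_iUnion]
  refine iSup_le fun m => ?_
  rw [dimH_bUnion (hDc m)]
  refine iSup₂_le fun p hp => ?_
  obtain ⟨h1, h2, h3⟩ := hDK m hp
  have hps : HasCompactSupport p.1 :=
    HasCompactSupport.of_support_subset_isCompact (Kn.isCompact m) ((subset_tsupport _).trans h1)
  -- Both the share `θ` of the heights and the loss `ε` by rounding are `√γ`.
  obtain ⟨B, hB, hcov⟩ := exists_cov_cheapAt hps h2 h3 (c := 8 * γ) (by positivity) hs0 hs1 hs0 x₀
  refine dimH_frequently_le hB.le (by positivity) ?_ hcov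
  rw [mul_div_assoc, Real.div_sqrt]
  linarith
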